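/- For $b>0$ let $\mathcal P([0,b])$ be the set of Borel probability measures on $[0,b]$, and on $\mathcal P([0,1])$ let $d_W(\xi_1,\xi_2)=\int_0^1|F_{\xi_1}(t)-F_{\xi_2}(t)|\,dt$ be the 1-Wasserstein metric, where $F_\xi(t)=\xi([0,t])$. Let $\mathbb S=[0,\infty)^2\setminus\{(0,0)\}$ and let $C([0,1],\mathcal P([0,1]))$ and $C(\mathbb S,\mathcal P([0,1]))$ be the sets of maps into $\mathcal P([0,1])$ that are continuous with respect to $d_W$. Put $d_\infty(\varphi_1,\varphi_2)=\sup_{t\in[0,1]}d_W(\varphi_1(t),\varphi_2(t))$ and $$d(G_1,G_2)=\sum_{n=1}^\infty\frac1{2^n}\,\frac{d_n(G_1,G_2)}{1+d_n(G_1,G_2)},\qquad d_n(G_1,G_2)=\sup_{(x,y)\in\mathbb S,\ x+y\ge 1/n}d_W(G_1(x,y),G_2(x,y)).$$ Let $0<m_0\le\beta<\infty$ and let $\mu,\nu\in\mathcal P([0,\beta])$ satisfy $\int k\,\mu(dk)=\int k\,\nu(dk)\ge m_0$. For a boundary datum $\varphi\in C([0,1],\mathcal P([0,1]))$ consider the problem: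 find $G\in C(\mathbb S,\mathcal P([0,1]))$ such that for all $(x,y)\in\mathbb S$ $$x\int_0^\beta\big(G(x,y)-G(x+k,y)\big)\,\mu(dk)+y\int_0^\beta\big(G(x,y)-G(x,y+k)\big)\,\nu(dk)=0$$ (an identity between signed measures, evaluated on every Borel subset of $[0,1]$), such that $G(0,y)=\varphi(0)$ for $y>0$ and $G(x,0)=\varphi(1)$ for $x>0$, and such that $d_W\big(G(x,y),\varphi(\tfrac{x}{x+y})\big)\to0$ as $x+y\to\infty$. Then: 1. For every boundary datum $\varphi$ the problem has exactly one solution $G^\varphi$. 2. For all boundary data $\varphi_1,\varphi_2$ we have $d(G^{\varphi_1},G^{\varphi_2})\le d_\infty(\varphi_1,\varphi_2)$; in particular the solution depends continuously on the boundary datum. 3. Let $\delta$ be the boundary datum that maps $t$ to the point mass $\delta_t$. The canonical solution $G^\delta$ is given by an urn, as follows. On any probability space let $(U_n)_{n\ge1}$ be an i.i.d. sequence of uniform variables on $[0,1]$ and, independently of it, let $(V_n,W_n)_{n\ge1}$ be an i.i.d. sequence of random vectors, each of whose two components is uniform on $[0,1]$. Let $q_\mu,q_\nu$ be the quantile functions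 of $\mu,\nu$. For $(x,y)\in\mathbb S$ put $(X_0,Y_0)=(x,y)$ and, for $n\ge0$, $$(X_{n+1},Y_{n+1})=\begin{cases}(X_n+q_\mu(V_{n+1}),\,Y_n)&\text{if }U_{n+1}\le X_n/(X_n+Y_n),\\(X_n,\,Y_n+q_\nu(W_{n+1}))&\text{otherwise.}\end{cases}$$ Then $X_n/(X_n+Y_n)$ converges almost surely, and $G^\delta(x,y)$ is the distribution of its limit. 4. For every boundary datum $\varphi$ and every $(x,y)\in\mathbb S$, $G^\varphi(x,y)=\Gamma_\varphi(G^\delta(x,y))$, where $\Gamma_\varphi(\xi)(B)=\int_0^1\varphi(t)(B)\,\xi(dt)$ for $\xi\in\mathcal P([0,1])$ and Borel $B\subseteq[0,1]$. -/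

import Mathlib

open MeasureTheory ProbabilityTheory Filter Topology

noncomputable section

/-! ### The space of probability distributions on `[0,1]` with the 1-Wasserstein metric -/

/-- Probability distributions on `[0,1]`. This is a synonym of `ProbabilityMeasure unitInterval`
that carries the 1-Wasserstein metric (and the topology of that metric). -/
def ProbI : Type := ProbabilityMeasure unitInterval

/-- The measure underlying an element of `ProbI`. -/
def ProbI.toMeasure (ξ : ProbI) : Measure unitInterval :=
  ProbabilityMeasure.toMeasure (show ProbabilityMeasure unitInterval from ξ)

/-- A probability measure on `[0,1]` as an element of `ProbI`. -/
def ProbI.mk (ξ : Measure unitInterval) (h : IsProbabilityMeasure ξ) : ProbI :=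
  (⟨ξ, h⟩ : ProbabilityMeasure unitInterval)

instance (ξ : ProbI) : IsProbabilityMeasure ξ.toMeasure :=
  inferInstanceAs (IsProbabilityMeasure (ProbabilityMeasure.toMeasure _))

theorem ProbI.toMeasure_mk (ξ : Measure unitInterval) (h : IsProbabilityMeasure ξ) :
    (ProbI.mk ξ h).toMeasure = ξ := rfl

theorem ProbI.ext_toMeasure {ξ η : ProbI} (h : ξ.toMeasure = η.toMeasure) : ξ = η :=
  Subtype.ext h

/-- The cumulative distribution function `F_ξ(t) = ξ([0,t])`. -/
def ProbI.cdf (ξ : ProbI) (t : ℝ) : ℝ := ξ.toMeasure.real {s | (s : ℝ) ≤ t}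

theorem ProbI.cdf_eq (ξ : ProbI) :
    ξ.cdf = ProbabilityTheory.cdf (ξ.toMeasure.map (Subtype.val : unitInterval → ℝ)) := by
  have : IsProbabilityMeasure (ξ.toMeasure.map (Subtype.val : unitInterval → ℝ)) :=
    Measure.isProbabilityMeasure_map measurable_subtype_coe.aemeasurable
  funext t
  rw [ProbabilityTheory.cdf_eq_real, map_measureReal_apply measurable_subtype_coe measurableSet_Iic]
  rfl

theorem ProbI.cdf_mono (ξ : ProbI) : Monotone ξ.cdf := by
  rw [ξ.cdf_eq]
  exact ProbabilityTheory.monotone_cdf _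

theorem ProbI.cdf_right_continuous (ξ : ProbI) (t : ℝ) :
    ContinuousWithinAt ξ.cdf (Set.Ici t) t := by
  rw [ξ.cdf_eq]
  exact StieltjesFunction.right_continuous _ t

theorem ProbI.cdf_intervalIntegrable (ξ : ProbI) (a b : ℝ) :
    IntervalIntegrable ξ.cdf volume a b :=
  ξ.cdf_mono.intervalIntegrable

theorem ProbI.cdf_of_one_le (ξ : ProbI) {t : ℝ} (ht : 1 ≤ t) : ξ.cdf t = 1 := by
  have : {s : unitInterval | (s : ℝ) ≤ t} = Set.univ :=
    Set.eq_univ_of_forall fun s => s.2.2.trans ht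
  simp [ProbI.cdf, this]

theorem ProbI.cdf_of_neg (ξ : ProbI) {t : ℝ} (ht : t < 0) : ξ.cdf t = 0 := by
  have : {s : unitInterval | (s : ℝ) ≤ t} = ∅ :=
    Set.eq_empty_of_forall_notMem fun s hs => absurd s.2.1 (not_le.2 (lt_of_le_of_lt hs ht))
  simp [ProbI.cdf, this]

theorem ProbI.eq_of_cdf_eq {ξ η : ProbI} (h : ξ.cdf = η.cdf) : ξ = η := by
  have h1 : IsProbabilityMeasure (ξ.toMeasure.map (Subtype.val : unitInterval → ℝ)) :=
    Measure.isProbabilityMeasure_map measurable_subtype_coe.aemeasurable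
  have h2 : IsProbabilityMeasure (η.toMeasure.map (Subtype.val : unitInterval → ℝ)) :=
    Measure.isProbabilityMeasure_map measurable_subtype_coe.aemeasurable
  have hm : ξ.toMeasure.map (Subtype.val : unitInterval → ℝ) = η.toMeasure.map Subtype.val := by
    apply Measure.eq_of_cdf
    rw [ξ.cdf_eq, η.cdf_eq] at h
    exact StieltjesFunction.ext fun x => congrFun h x
  have he : MeasurableEmbedding (Subtype.val : unitInterval → ℝ) :=
    MeasurableEmbedding.subtype_coe measurableSet_Icc
  apply ProbI.ext_toMeasure
  rw [← he.comap_map ξ.toMeasure, hm, he.comap_map]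

/-- The 1-Wasserstein distance `d_W(ξ,η) = ∫₀¹ |F_ξ(t) - F_η(t)| dt`. -/
def wassersteinDist (ξ η : ProbI) : ℝ := ∫ t in (0 : ℝ)..1, |ξ.cdf t - η.cdf t|

theorem wassersteinDist_intervalIntegrable (ξ η : ProbI) (a b : ℝ) :
    IntervalIntegrable (fun t => |ξ.cdf t - η.cdf t|) volume a b :=
  ((ξ.cdf_intervalIntegrable a b).sub (η.cdf_intervalIntegrable a b)).abs

theorem eq_of_wassersteinDist_eq_zero {ξ η : ProbI} (h : wassersteinDist ξ η = 0) : ξ = η := by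
  have hae : (fun t => |ξ.cdf t - η.cdf t|) =ᵐ[volume.restrict (Set.Ioc (0 : ℝ) 1)] 0 :=
    (intervalIntegral.integral_eq_zero_iff_of_le_of_nonneg_ae zero_le_one
      (Eventually.of_forall fun _ => abs_nonneg _)
      (wassersteinDist_intervalIntegrable ξ η 0 1)).1 h
  apply ProbI.eq_of_cdf_eq
  funext t
  rcases lt_or_ge t 0 with ht | ht
  · rw [ξ.cdf_of_neg ht, η.cdf_of_neg ht]
  rcases le_or_gt 1 t with ht1 | ht1
  · rw [ξ.cdf_of_one_le ht1, η.cdf_of_one_le ht1]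
  by_contra hne
  have hc : ContinuousWithinAt (fun s => ξ.cdf s - η.cdf s) (Set.Ici t) t :=
    (ξ.cdf_right_continuous t).sub (η.cdf_right_continuous t)
  have hev : ∀ᶠ s in 𝓝[≥] t, ξ.cdf s - η.cdf s ≠ 0 := hc.eventually_ne (sub_ne_zero.2 hne)
  obtain ⟨u, hu, hsub⟩ := (mem_nhdsGE_iff_exists_Ico_subset).1 hev
  have hu' : t < u := hu
  have hlt : t < min u 1 := lt_min hu' ht1
  rw [Filter.EventuallyEq, ae_restrict_iff' measurableSet_Ioc, ae_iff] at hae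
  have hle : volume (Set.Ioo t (min u 1)) ≤ 0 := by
    rw [← hae]
    apply measure_mono
    intro s hs hcon
    have h1 : s ∈ Set.Ioc (0 : ℝ) 1 :=
      ⟨ht.trans_lt hs.1, (hs.2.trans_le (min_le_right _ _)).le⟩
    have h2 := hcon h1
    exact hsub ⟨hs.1.le, hs.2.trans_le (min_le_left _ _)⟩ (by simpa using h2)
  rw [Real.volume_Ioo] at hle
  have := ENNReal.ofReal_pos.2 (sub_pos.2 hlt)
  exact absurd hle (not_le.2 this)

instance : MetricSpace ProbI where
  dist := wassersteinDist
  dist_self ξ := by simp [wassersteinDist]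
  dist_comm ξ η := by simp only [wassersteinDist, abs_sub_comm]
  dist_triangle ξ η ζ := by
    simp only [wassersteinDist]
    rw [← intervalIntegral.integral_add (wassersteinDist_intervalIntegrable ξ η 0 1)
      (wassersteinDist_intervalIntegrable η ζ 0 1)]
    exact intervalIntegral.integral_mono_on zero_le_one
      (wassersteinDist_intervalIntegrable ξ ζ 0 1)
      ((wassersteinDist_intervalIntegrable ξ η 0 1).add
        (wassersteinDist_intervalIntegrable η ζ 0 1))
      fun t _ => abs_sub_le _ _ _
  eq_of_dist_eq_zero h := eq_of_wassersteinDist_eq_zero h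

theorem ProbI.dist_def (ξ η : ProbI) :
    dist ξ η = ∫ t in (0 : ℝ)..1, |ξ.cdf t - η.cdf t| := rfl

/-! ### Boundary data

A boundary datum is an element of `C(unitInterval, ProbI)`. Mathlib's distance on this space of
continuous maps is `d_∞(φ₁,φ₂) = sup_t d_W(φ₁(t),φ₂(t))`. -/

/-- The point mass at `t`. -/
def pointMass (t : unitInterval) : ProbI := ProbI.mk (Measure.dirac t) inferInstance

theorem pointMass_cdf (t : unitInterval) (u : ℝ) :
    (pointMass t).cdf u = Set.indicator (Set.Ici (t : ℝ)) (fun _ => (1 : ℝ)) u := by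
  have hm : MeasurableSet {s : unitInterval | (s : ℝ) ≤ u} :=
    measurableSet_le measurable_subtype_coe measurable_const
  rw [ProbI.cdf, pointMass, ProbI.toMeasure_mk, measureReal_def, Measure.dirac_apply' _ hm]
  by_cases h : (t : ℝ) ≤ u <;> simp [Set.indicator, h]

theorem dist_pointMass_le (s t : unitInterval) : dist (pointMass s) (pointMass t) ≤ dist s t := by
  wlog hst : (s : ℝ) ≤ t generalizing s t
  · rw [dist_comm, dist_comm s t]
    exact this t s (le_of_not_ge hst)
  have hpt : ∀ u : ℝ, |(pointMass s).cdf u - (pointMass t).cdf u|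
      = Set.indicator (Set.Ico (s : ℝ) t) (fun _ => (1 : ℝ)) u := by
    intro u
    rw [pointMass_cdf, pointMass_cdf]
    by_cases h1 : (s : ℝ) ≤ u
    · by_cases h2 : (t : ℝ) ≤ u
      · simp [Set.indicator, h1, h2]
      · simp [Set.indicator, h1, h2]
    · have h2 : ¬ (t : ℝ) ≤ u := fun h => h1 (hst.trans h)
      simp [Set.indicator, h1, h2]
  rw [ProbI.dist_def, Subtype.dist_eq, Real.dist_eq, abs_sub_comm, abs_of_nonneg (sub_nonneg.2 hst)]
  simp only [hpt]
  rw [intervalIntegral.integral_of_le zero_le_one, integral_indicator_const _ measurableSet_Ico,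
    smul_eq_mul, mul_one]
  calc (volume.restrict (Set.Ioc (0 : ℝ) 1)).real (Set.Ico (s : ℝ) t)
      ≤ volume.real (Set.Ico (s : ℝ) t) :=
        ENNReal.toReal_mono (by simp) (Measure.restrict_apply_le _ _)
    _ = t - s := by simp [hst]

/-- The boundary datum `δ`, which maps `t` to the point mass at `t`. -/
def deltaDatum : C(unitInterval, ProbI) where
  toFun := pointMass
  continuous_toFun := by
    have : LipschitzWith 1 pointMass := LipschitzWith.of_dist_le_mul fun s t => by
      simpa using dist_pointMass_le s t
    exact this.continuous

/-! ### The map `Γ_φ` -/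

theorem ProbI.continuous_integral_cdf {a b : ℝ} (ha : 0 ≤ a) (hab : a ≤ b) (hb : b ≤ 1) :
    Continuous fun ξ : ProbI => ∫ t in a..b, ξ.cdf t := by
  have : LipschitzWith 1 fun ξ : ProbI => ∫ t in a..b, ξ.cdf t := by
    apply LipschitzWith.of_dist_le_mul
    intro ξ η
    rw [NNReal.coe_one, one_mul, Real.dist_eq, ← intervalIntegral.integral_sub
      (ξ.cdf_intervalIntegrable a b) (η.cdf_intervalIntegrable a b), ProbI.dist_def]
    refine (intervalIntegral.abs_integral_le_integral_abs hab).trans ?_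
    exact intervalIntegral.integral_mono_interval ha hab hb
      (Eventually.of_forall fun _ => abs_nonneg _) (wassersteinDist_intervalIntegrable ξ η 0 1)
  exact this.continuous

theorem ProbI.tendsto_average_cdf (ξ : ProbI) {s : ℝ} (hs : s < 1) :
    Tendsto (fun n : ℕ => ((1 - s) / (n + 1))⁻¹ * ∫ t in s..(s + (1 - s) / (n + 1)), ξ.cdf t)
      atTop (𝓝 (ξ.cdf s)) := by
  have hpos : ∀ n : ℕ, 0 < (1 - s) / (n + 1) := fun n => div_pos (sub_pos.2 hs) (by positivity)
  have hlim : Tendsto (fun n : ℕ => s + (1 - s) / ((n : ℝ) + 1)) atTop (𝓝[≥] s) := by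
    apply tendsto_nhdsWithin_iff.2
    constructor
    · have h0 : Tendsto (fun n : ℕ => (1 - s) * (1 / ((n : ℝ) + 1))) atTop (𝓝 ((1 - s) * 0)) :=
        tendsto_one_div_add_atTop_nhds_zero_nat.const_mul _
      have h1 := h0.const_add s
      simpa [div_eq_mul_inv] using h1
    · exact Eventually.of_forall fun n => by
        have := hpos n
        simp only [Set.mem_Ici]
        linarith
  have hup : Tendsto (fun n : ℕ => ξ.cdf (s + (1 - s) / ((n : ℝ) + 1))) atTop (𝓝 (ξ.cdf s)) :=
    (ξ.cdf_right_continuous s).tendsto.comp hlim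
  refine tendsto_of_tendsto_of_tendsto_of_le_of_le tendsto_const_nhds hup ?_ ?_
  · intro n
    have h := hpos n
    have hle : s ≤ s + (1 - s) / ((n : ℝ) + 1) := by linarith
    have h2 : ∫ _ in s..(s + (1 - s) / ((n : ℝ) + 1)), ξ.cdf s
        ≤ ∫ t in s..(s + (1 - s) / ((n : ℝ) + 1)), ξ.cdf t :=
      intervalIntegral.integral_mono_on hle (by simp) (ξ.cdf_intervalIntegrable _ _)
        fun t ht => ξ.cdf_mono ht.1
    rw [intervalIntegral.integral_const, add_sub_cancel_left, smul_eq_mul] at h2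
    change ξ.cdf s ≤ ((1 - s) / (n + 1))⁻¹ * ∫ t in s..(s + (1 - s) / (n + 1)), ξ.cdf t
    rw [inv_mul_eq_div, le_div_iff₀ h]
    linarith
  · intro n
    have h := hpos n
    have hle : s ≤ s + (1 - s) / ((n : ℝ) + 1) := by linarith
    have h2 : ∫ t in s..(s + (1 - s) / ((n : ℝ) + 1)), ξ.cdf t
        ≤ ∫ _ in s..(s + (1 - s) / ((n : ℝ) + 1)), ξ.cdf (s + (1 - s) / ((n : ℝ) + 1)) :=
      intervalIntegral.integral_mono_on hle (ξ.cdf_intervalIntegrable _ _) (by simp)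
        fun t ht => ξ.cdf_mono ht.2
    rw [intervalIntegral.integral_const, add_sub_cancel_left, smul_eq_mul] at h2
    change ((1 - s) / (n + 1))⁻¹ * ∫ t in s..(s + (1 - s) / (n + 1)), ξ.cdf t
      ≤ ξ.cdf (s + (1 - s) / ((n : ℝ) + 1))
    rw [inv_mul_eq_div, div_le_iff₀ h]
    linarith

theorem measurable_cdf_comp (φ : C(unitInterval, ProbI)) (s : ℝ) :
    Measurable fun t => (φ t).cdf s := by
  rcases lt_or_ge s 0 with h0 | h0
  · simp only [fun t => (φ t).cdf_of_neg h0, measurable_const]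
  rcases le_or_gt 1 s with h1 | h1
  · simp only [fun t => (φ t).cdf_of_one_le h1, measurable_const]
  refine measurable_of_tendsto_metrizable (f := fun (n : ℕ) t =>
    ((1 - s) / (n + 1))⁻¹ * ∫ u in s..(s + (1 - s) / (n + 1)), (φ t).cdf u) ?_
    (tendsto_pi_nhds.2 fun t => (φ t).tendsto_average_cdf h1)
  intro n
  have hn : (0 : ℝ) < n + 1 := by positivity
  have hpos : 0 < (1 - s) / ((n : ℝ) + 1) := div_pos (sub_pos.2 h1) hn
  have hle : (1 - s) / ((n : ℝ) + 1) ≤ 1 - s :=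
    div_le_self (sub_pos.2 h1).le (by linarith [Nat.cast_nonneg (α := ℝ) n])
  exact (((ProbI.continuous_integral_cdf h0 (by linarith) (by linarith)).comp
    φ.continuous).measurable).const_mul _

theorem measurable_toMeasure_comp (φ : C(unitInterval, ProbI)) :
    Measurable fun t => (φ t).toMeasure := by
  have hgen : (inferInstance : MeasurableSpace unitInterval)
      = MeasurableSpace.generateFrom (Set.range (Set.Iic : unitInterval → Set unitInterval)) :=
    (BorelSpace.measurable_eq (α := unitInterval)).trans (borel_eq_generateFrom_Iic unitInterval)
  refine Measurable.measure_of_isPiSystem_of_isProbabilityMeasure hgen isPiSystem_Iic ?_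
  rintro _ ⟨s, rfl⟩
  have h := (measurable_cdf_comp φ (s : ℝ)).ennreal_ofReal
  have : ∀ t, ENNReal.ofReal ((φ t).cdf (s : ℝ)) = (φ t).toMeasure (Set.Iic s) := fun t => by
    rw [ProbI.cdf, measureReal_def, ENNReal.ofReal_toReal (measure_ne_top _ _)]
    rfl
  simpa only [this] using h

/-- The map `Γ_φ`, given by `Γ_φ(ξ)(B) = ∫ φ(t)(B) ξ(dt)` (see `Gamma_apply`). -/
def Gamma (φ : C(unitInterval, ProbI)) (ξ : ProbI) : ProbI :=
  ProbI.mk (ξ.toMeasure.bind fun t => (φ t).toMeasure)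
    ⟨by
      rw [Measure.bind_apply MeasurableSet.univ (measurable_toMeasure_comp φ).aemeasurable]
      simp⟩

theorem Gamma_apply (φ : C(unitInterval, ProbI)) (ξ : ProbI) {B : Set unitInterval}
    (hB : MeasurableSet B) :
    (Gamma φ ξ).toMeasure B = ∫⁻ t, (φ t).toMeasure B ∂ξ.toMeasure :=
  Measure.bind_apply hB (measurable_toMeasure_comp φ).aemeasurable

/-! ### The domain `𝕊` -/

/-- `𝕊 = [0,∞) × [0,∞) \ {(0,0)}`. -/
def Quadrant : Type := {p : ℝ × ℝ // 0 ≤ p.1 ∧ 0 ≤ p.2 ∧ p ≠ (0, 0)}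

instance : TopologicalSpace Quadrant :=
  inferInstanceAs (TopologicalSpace {p : ℝ × ℝ // 0 ≤ p.1 ∧ 0 ≤ p.2 ∧ p ≠ (0, 0)})

namespace Quadrant

/-- The first coordinate. -/
def x (p : Quadrant) : ℝ := p.1.1

/-- The second coordinate. -/
def y (p : Quadrant) : ℝ := p.1.2

theorem x_nonneg (p : Quadrant) : 0 ≤ p.x := p.2.1

theorem y_nonneg (p : Quadrant) : 0 ≤ p.y := p.2.2.1

theorem sum_pos (p : Quadrant) : 0 < p.x + p.y := by
  rcases (add_nonneg p.x_nonneg p.y_nonneg).lt_or_eq with h | h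
  · exact h
  · refine absurd (Prod.ext ?_ ?_) p.2.2.2
    · change p.x = 0
      linarith [p.x_nonneg, p.y_nonneg]
    · change p.y = 0
      linarith [p.x_nonneg, p.y_nonneg]

/-- The ratio `x / (x + y)`, a point of `[0,1]`. -/
def ratio (p : Quadrant) : unitInterval :=
  ⟨p.x / (p.x + p.y), div_nonneg p.x_nonneg p.sum_pos.le,
    (div_le_one p.sum_pos).2 (le_add_of_nonneg_right p.y_nonneg)⟩

/-- The point `(x + k, y)`, for `k ∈ [0,β]`. -/
def shiftX {β : ℝ} (p : Quadrant) (k : Set.Icc (0 : ℝ) β) : Quadrant :=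
  ⟨(p.x + k, p.y), add_nonneg p.x_nonneg k.2.1, p.y_nonneg, fun h => by
    have h1 : p.x + k = 0 := congrArg Prod.fst h
    have h2 : p.y = 0 := congrArg Prod.snd h
    linarith [p.sum_pos, k.2.1]⟩

/-- The point `(x, y + k)`, for `k ∈ [0,β]`. -/
def shiftY {β : ℝ} (p : Quadrant) (k : Set.Icc (0 : ℝ) β) : Quadrant :=
  ⟨(p.x, p.y + k), p.x_nonneg, add_nonneg p.y_nonneg k.2.1, fun h => by
    have h1 : p.x = 0 := congrArg Prod.fst h
    have h2 : p.y + k = 0 := congrArg Prod.snd h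
    linarith [p.sum_pos, k.2.1]⟩

end Quadrant

/-- `d_n(G₁,G₂)`, the supremum of `d_W(G₁(x,y),G₂(x,y))` over `𝕊_n = {(x,y) ∈ 𝕊 : x + y ≥ 1/n}`. -/
def solutionDistOn (n : ℕ) (G₁ G₂ : C(Quadrant, ProbI)) : ℝ :=
  ⨆ p : {p : Quadrant // 1 / (n : ℝ) ≤ p.x + p.y}, dist (G₁ p) (G₂ p)

/-- The distance `d(G₁,G₂) = ∑_{n ≥ 1} 2⁻ⁿ d_n(G₁,G₂) / (1 + d_n(G₁,G₂))` on `C(𝕊, P([0,1]))`;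
the sum runs over `n + 1` for `n : ℕ`. -/
def solutionDist (G₁ G₂ : C(Quadrant, ProbI)) : ℝ :=
  ∑' n : ℕ, 1 / 2 ^ (n + 1) *
    (solutionDistOn (n + 1) G₁ G₂ / (1 + solutionDistOn (n + 1) G₁ G₂))

/-! ### Parameters and the functional-equation problem -/

/-- The set of parameters: pairs of probability distributions on `[0,β]` with equal means, the
common mean being at least `m₀`. -/
def paramSet (β m₀ : ℝ) :
    Set (ProbabilityMeasure (Set.Icc (0 : ℝ) β) × ProbabilityMeasure (Set.Icc (0 : ℝ) β)) :=
  {p | ∫ k, (k : ℝ) ∂(p.1 : Measure (Set.Icc (0 : ℝ) β))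
        = ∫ k, (k : ℝ) ∂(p.2 : Measure (Set.Icc (0 : ℝ) β)) ∧
      m₀ ≤ ∫ k, (k : ℝ) ∂(p.1 : Measure (Set.Icc (0 : ℝ) β))}

/-- `G` solves the functional-equation problem with parameters `(μ,ν)` and boundary datum `φ`.
The equation between signed measures is read on every Borel set `B`. -/
structure IsSolution {β : ℝ} (μ ν : ProbabilityMeasure (Set.Icc (0 : ℝ) β))
    (φ : C(unitInterval, ProbI)) (G : C(Quadrant, ProbI)) : Prop where
  equation : ∀ (p : Quadrant) (B : Set unitInterval), MeasurableSet B →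
    p.x * (∫ k, ((G p).toMeasure.real B - (G (p.shiftX k)).toMeasure.real B)
        ∂(μ : Measure (Set.Icc (0 : ℝ) β))) +
      p.y * (∫ k, ((G p).toMeasure.real B - (G (p.shiftY k)).toMeasure.real B)
        ∂(ν : Measure (Set.Icc (0 : ℝ) β))) = 0
  y_axis : ∀ p : Quadrant, p.x = 0 → G p = φ 0
  x_axis : ∀ p : Quadrant, p.y = 0 → G p = φ 1
  at_infinity : Tendsto (fun p : Quadrant => dist (G p) (φ p.ratio))
    (comap (fun p : Quadrant => p.x + p.y) atTop) (𝓝 0)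

/-! ### The randomly reinforced urn -/

/-- The quantile function `q_μ(t) = inf {z ∈ [0,β] : μ([0,z]) ≥ t}`. -/
def quantile {β : ℝ} (μ : ProbabilityMeasure (Set.Icc (0 : ℝ) β)) (t : unitInterval) :
    Set.Icc (0 : ℝ) β :=
  ⟨sInf {z : ℝ | z ∈ Set.Icc (0 : ℝ) β ∧
      (t : ℝ) ≤ (μ : Measure (Set.Icc (0 : ℝ) β)).real {k | (k : ℝ) ≤ z}}, by
    have hβ : 0 ≤ β := by
      obtain ⟨k⟩ := μ.nonempty
      exact k.2.1.trans k.2.2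
    have huniv : {k : Set.Icc (0 : ℝ) β | (k : ℝ) ≤ β} = Set.univ :=
      Set.eq_univ_of_forall fun k => k.2.2
    have hmem : β ∈ {z : ℝ | z ∈ Set.Icc (0 : ℝ) β ∧
        (t : ℝ) ≤ (μ : Measure (Set.Icc (0 : ℝ) β)).real {k | (k : ℝ) ≤ z}} :=
      ⟨⟨hβ, le_rfl⟩, by
        rw [huniv, probReal_univ]
        exact t.2.2⟩
    exact ⟨le_csInf ⟨β, hmem⟩ fun z hz => hz.1.1, csInf_le ⟨0, fun z hz => hz.1.1⟩ hmem⟩⟩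

/-- The randomness that drives the urn: `(U n)` is an i.i.d. sequence of uniform variables on
`[0,1]`, `(V n, W n)` is an i.i.d. sequence of random vectors with uniform components (and an
arbitrary joint law of the two components), and the two sequences are independent. -/
structure IsUrnNoise {Ω : Type*} [MeasurableSpace Ω] (P : Measure Ω)
    (U V W : ℕ → Ω → unitInterval) : Prop where
  measurable_U : ∀ n, Measurable (U n)
  measurable_V : ∀ n, Measurable (V n)
  measurable_W : ∀ n, Measurable (W n)
  law_U : ∀ n, P.map (U n) = volume
  law_V : ∀ n, P.map (V n) = volume
  law_W : ∀ n, P.map (W n) = volume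
  indep_U : iIndepFun U P
  indep_VW : iIndepFun (fun n ω => (V n ω, W n ω)) P
  identDistrib_VW : ∀ n, IdentDistrib (fun ω => (V n ω, W n ω)) (fun ω => (V 0 ω, W 0 ω)) P P
  indep_U_VW : IndepFun (fun ω n => U n ω) (fun ω n => (V n ω, W n ω)) P

/-- The composition `(X_n, Y_n)` of the urn after `n` draws, started from `p`. In draw `n + 1`,
which uses `U n`, `V n`, `W n`, a black ball is drawn if `U n ≤ X_n / (X_n + Y_n)`, and then
`q_μ(V n)` black balls are added; otherwise `q_ν(W n)` white balls are added. -/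
def urn {β : ℝ} (μ ν : ProbabilityMeasure (Set.Icc (0 : ℝ) β)) {Ω : Type*}
    (U V W : ℕ → Ω → unitInterval) (p : Quadrant) (ω : Ω) : ℕ → Quadrant
  | 0 => p
  | n + 1 =>
    if U n ω ≤ (urn μ ν U V W p ω n).ratio
    then (urn μ ν U V W p ω n).shiftX (quantile μ (V n ω))
    else (urn μ ν U V W p ω n).shiftY (quantile ν (W n ω))

end

/-! Divided by $x+y$, the functional equation says that $p\mapsto\int f\,dG(p)$ is fixed by the
transition operator `stepOp` of the urn, for every continuous $f$ on $[0,1]$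
(`equation_iff_harmonic`). A solution is thus a harmonic map, with boundary value $\varphi$ at
infinity. If the total mass $s_n$ of the urn tends to infinity and its proportion $R_n$ converges to
$Z$, then $\int f\,dG(p)=E\int f\,dG(X_n,Y_n)\to E\int f\,d\varphi(Z)$, so $G(p)$ is
$\Gamma_\varphi$ of the law of $Z$. This gives uniqueness and the formula for $G^\varphi$
(`IsSolution.eq_Gamma`). Conversely, the limit law $F$ is harmonic (`IsLimitLaw.stepAt_integral`),
and $\Gamma_\varphi\circ F$ is a solution because $\Gamma_\varphi$ respects mixtures, is continuous
and sends $\delta_t$ to $\varphi(t)$.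

All convergence comes from one Lyapunov function, $(R-a)^2+B/s$. As the two means agree, the drift
and the mean square increment of $R$ are of order $s^{-2}$, while $1/s$ falls in the mean by at
least $m/(s(s+\beta))$. With $Bm=3\beta^2+1$ the function drops in the mean by at least
$1/(s(s+\beta))$, whatever $a\in[0,1]$ is (`stepAt_lyapunov_le`). Summing the drops shows
$s_n\to\infty$; for $a=0$ supermartingale convergence yields the limit $Z$; for $a$ frozen at $R_N$
one gets $E(Z-R_N)^2\le E(B/s_N)$ (`IsUrnNoise.integral_sq_sub_le`). At $N=0$ the last bound is the
condition at infinity, and for large $N$ it is a locally uniform approximation, whence $F$ is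
continuous.

On $[0,1]$ the Wasserstein metric induces the weak topology (`ProbI.homeo`), so equality and
continuity can be tested on continuous $f$. The metric is convex under mixtures
(`ProbI.dist_mix_le`), which gives both the coupling bound and the Lipschitz estimate. -/

noncomputable section

/-! ### Mixtures of elements of `ProbI` -/

namespace ProbI

/-- The mixture `∫ ξ(a) ρ(da)`. -/
def mix {α : Type*} [MeasurableSpace α] (ρ : Measure α) [IsProbabilityMeasure ρ] (ξ : α → ProbI)
    (h : Measurable fun a => (ξ a).toMeasure) : ProbI :=
  ProbI.mk (ρ.bind fun a => (ξ a).toMeasure)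
    ⟨by
      rw [Measure.bind_apply MeasurableSet.univ h.aemeasurable]
      simp⟩

theorem cdf_nonneg (ξ : ProbI) (t : ℝ) : 0 ≤ ξ.cdf t := measureReal_nonneg

theorem cdf_le_one (ξ : ProbI) (t : ℝ) : ξ.cdf t ≤ 1 := measureReal_le_one

variable {α : Type*} [MeasurableSpace α]

/-- The Markov kernel given by a measurable family of elements of `ProbI`. -/
def kernel (ξ : α → ProbI) (h : Measurable fun a => (ξ a).toMeasure) : Kernel α unitInterval where
  toFun a := (ξ a).toMeasure
  measurable' := h

instance (ξ : α → ProbI) (h : Measurable fun a => (ξ a).toMeasure) :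
    IsMarkovKernel (kernel ξ h) :=
  ⟨fun a => inferInstanceAs (IsProbabilityMeasure (ξ a).toMeasure)⟩

/-- The value is the kernel measure of a section of the measurable set $\{s\le t\}$. Joint
measurability is what Fubini needs in `dist_mix_le`. -/
theorem measurable_uncurry_cdf {ξ : α → ProbI} (h : Measurable fun a => (ξ a).toMeasure) :
    Measurable fun q : α × ℝ => (ξ q.1).cdf q.2 := by
  have hset : MeasurableSet {r : (α × ℝ) × unitInterval | (r.2 : ℝ) ≤ r.1.2} :=
    measurableSet_le (measurable_subtype_coe.comp measurable_snd)
      (measurable_snd.comp measurable_fst)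
  exact (Kernel.measurable_kernel_prodMk_left
    (κ := (kernel ξ h).comap Prod.fst measurable_fst) hset).ennreal_toReal

theorem measurableSet_coe_le (t : ℝ) : MeasurableSet {s : unitInterval | (s : ℝ) ≤ t} :=
  measurableSet_le measurable_subtype_coe measurable_const

theorem mix_cdf (ρ : Measure α) [IsProbabilityMeasure ρ] {ξ : α → ProbI}
    (h : Measurable fun a => (ξ a).toMeasure) (t : ℝ) :
    (mix ρ ξ h).cdf t = ∫ a, (ξ a).cdf t ∂ρ := by
  have hm : Measurable fun a => (ξ a).toMeasure {s : unitInterval | (s : ℝ) ≤ t} :=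
    (Measure.measurable_coe (measurableSet_coe_le t)).comp h
  rw [cdf, mix, toMeasure_mk, measureReal_def,
    Measure.bind_apply (measurableSet_coe_le t) h.aemeasurable]
  exact (integral_toReal hm.aemeasurable (Eventually.of_forall fun a => measure_lt_top _ _)).symm

theorem integrable_uncurry_abs_cdf_sub (ρ : Measure α) [IsProbabilityMeasure ρ] {ξ η : α → ProbI}
    (hξ : Measurable fun a => (ξ a).toMeasure) (hη : Measurable fun a => (η a).toMeasure) :
    Integrable (fun q : α × ℝ => |(ξ q.1).cdf q.2 - (η q.1).cdf q.2|)
      (ρ.prod (volume.restrict (Set.Ioc (0 : ℝ) 1))) := by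
  refine Integrable.of_bound
    (((measurable_uncurry_cdf hξ).sub (measurable_uncurry_cdf hη)).abs.aestronglyMeasurable) 1
    (Eventually.of_forall fun q => ?_)
  rw [Real.norm_eq_abs, abs_abs]
  exact abs_le.2 ⟨by linarith [(ξ q.1).cdf_nonneg q.2, (η q.1).cdf_le_one q.2],
    by linarith [(η q.1).cdf_nonneg q.2, (ξ q.1).cdf_le_one q.2]⟩

theorem integrable_dist (ρ : Measure α) [IsProbabilityMeasure ρ] {ξ η : α → ProbI}
    (hξ : Measurable fun a => (ξ a).toMeasure) (hη : Measurable fun a => (η a).toMeasure) :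
    Integrable (fun a => dist (ξ a) (η a)) ρ := by
  simp only [dist_def, intervalIntegral.integral_of_le zero_le_one]
  exact (integrable_uncurry_abs_cdf_sub ρ hξ hη).integral_prod_left

/-- The Wasserstein distance is convex. -/
theorem dist_mix_le (ρ : Measure α) [IsProbabilityMeasure ρ] {ξ η : α → ProbI}
    (hξ : Measurable fun a => (ξ a).toMeasure) (hη : Measurable fun a => (η a).toMeasure) :
    dist (mix ρ ξ hξ) (mix ρ η hη) ≤ ∫ a, dist (ξ a) (η a) ∂ρ := by
  have hint := integrable_uncurry_abs_cdf_sub ρ hξ hη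
  have hi : ∀ {ζ : α → ProbI}, (Measurable fun a => (ζ a).toMeasure) → ∀ t,
      Integrable (fun a => (ζ a).cdf t) ρ := fun {ζ} hζ t =>
    Integrable.of_bound ((measurable_uncurry_cdf hζ).comp
      (measurable_id.prodMk measurable_const)).aestronglyMeasurable 1
      (Eventually.of_forall fun a => by
        change |(ζ a).cdf t| ≤ 1
        rw [abs_of_nonneg ((ζ a).cdf_nonneg t)]
        exact (ζ a).cdf_le_one t)
  simp only [dist_def, intervalIntegral.integral_of_le zero_le_one]
  -- After Fubini the claim holds for each $t$ separately: the absolute value of a mean is at most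
  -- the mean of the absolute values.
  rw [integral_integral_swap hint]
  refine integral_mono ?_ hint.integral_prod_right fun t => ?_
  · exact ((intervalIntegrable_iff_integrableOn_Ioc_of_le zero_le_one).1
      (wassersteinDist_intervalIntegrable _ _ 0 1))
  · change |_| ≤ _
    rw [mix_cdf, mix_cdf, ← integral_sub (hi hξ t) (hi hη t)]
    exact abs_integral_le_integral_abs

theorem measurable_pointMass_comp {X : α → unitInterval} (hX : Measurable X) :
    Measurable fun a => (pointMass (X a)).toMeasure :=
  Measure.measurable_dirac.comp hX

/-- The law of a `[0,1]`-valued random variable. -/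
def law (P : Measure α) [IsProbabilityMeasure P] (X : α → unitInterval) (hX : Measurable X) :
    ProbI :=
  ProbI.mk (P.map X) (Measure.isProbabilityMeasure_map hX.aemeasurable)

theorem law_toMeasure (P : Measure α) [IsProbabilityMeasure P] {X : α → unitInterval}
    (hX : Measurable X) : (law P X hX).toMeasure = P.map X := rfl

/-- Over a common probability space two laws become mixtures of point masses with the same mixing
measure, so the coupling bound follows from convexity. -/
theorem law_eq_mix (P : Measure α) [IsProbabilityMeasure P] {X : α → unitInterval}
    (hX : Measurable X) :
    law P X hX = mix P (fun a => pointMass (X a)) (measurable_pointMass_comp hX) :=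
  ext_toMeasure <| (Measure.bind_dirac_eq_map P hX).symm

/-- The Wasserstein distance is bounded by the cost of any coupling. -/
theorem dist_law_le (P : Measure α) [IsProbabilityMeasure P] {X Y : α → unitInterval}
    (hX : Measurable X) (hY : Measurable Y) :
    dist (law P X hX) (law P Y hY) ≤ ∫ a, dist (X a) (Y a) ∂P := by
  rw [law_eq_mix, law_eq_mix]
  refine (dist_mix_le P _ _).trans (integral_mono (integrable_dist P
    (measurable_pointMass_comp hX) (measurable_pointMass_comp hY)) ?_
    fun a => dist_pointMass_le _ _)
  exact Integrable.of_bound (hX.dist hY).aestronglyMeasurable 1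
    (Eventually.of_forall fun a => by
      rw [Real.norm_eq_abs, abs_of_nonneg dist_nonneg]
      rw [Subtype.dist_eq, Real.dist_eq]
      exact abs_le.2 ⟨by linarith [(X a).2.1, (Y a).2.2], by linarith [(X a).2.2, (Y a).2.1]⟩)

end ProbI

/-! ### The Wasserstein metric metrizes weak convergence -/

namespace ProbI

/-- A finite measure has only countably many atoms. Off them the frontier of $\{s\le t\}$ is a null
set. -/
theorem ae_measure_coe_eq_zero (ξ : ProbI) :
    ∀ᵐ t : ℝ, ξ.toMeasure {s : unitInterval | (s : ℝ) = t} = 0 := by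
  have hc : Set.Countable {t : ℝ | 0 < ξ.toMeasure {s : unitInterval | (s : ℝ) = t}} :=
    Measure.countable_meas_level_set_pos measurable_subtype_coe
  filter_upwards [hc.ae_notMem volume] with t ht
  simpa using ht

/-- The identity from the weak topology to the Wasserstein metric. -/
def ofProbabilityMeasure : ProbabilityMeasure unitInterval ≃ ProbI := Equiv.refl _

/-- Under weak convergence the distribution functions converge wherever the limit has no atom, hence
almost everywhere, and dominated convergence applies. Continuity of the inverse then comes from
compactness. -/
theorem continuous_ofProbabilityMeasure : Continuous ofProbabilityMeasure := by
  refine continuous_iff_continuousAt.2 fun ξ => ?_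
  rw [ContinuousAt, tendsto_iff_dist_tendsto_zero]
  simp only [dist_def, intervalIntegral.integral_of_le zero_le_one]
  suffices h : Tendsto (fun η => ∫ t in Set.Ioc (0 : ℝ) 1,
      |(ofProbabilityMeasure η).cdf t - (ofProbabilityMeasure ξ).cdf t|) (𝓝 ξ)
      (𝓝 (∫ _ in Set.Ioc (0 : ℝ) 1, (0 : ℝ))) by
    rw [integral_zero] at h
    exact h
  refine tendsto_integral_filter_of_dominated_convergence (fun _ => (1 : ℝ)) ?_ ?_
    ?_ ?_
  · exact Eventually.of_forall fun η => ((intervalIntegrable_iff_integrableOn_Ioc_of_le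
      zero_le_one).1 (wassersteinDist_intervalIntegrable (ofProbabilityMeasure η)
        (ofProbabilityMeasure ξ) 0 1)).aestronglyMeasurable
  · refine Eventually.of_forall fun η => Eventually.of_forall fun t => ?_
    rw [Real.norm_eq_abs, abs_abs]
    have h1 := (ofProbabilityMeasure η).cdf_nonneg t
    have h2 := (ofProbabilityMeasure η).cdf_le_one t
    have h3 := (ofProbabilityMeasure ξ).cdf_nonneg t
    have h4 := (ofProbabilityMeasure ξ).cdf_le_one t
    exact abs_le.2 ⟨by linarith, by linarith⟩
  · exact integrable_const 1
  · filter_upwards [ae_restrict_of_ae (ofProbabilityMeasure ξ).ae_measure_coe_eq_zero] with t ht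
    have hfr : (ξ : Measure unitInterval) (frontier {s : unitInterval | (s : ℝ) ≤ t}) = 0 :=
      measure_mono_null (frontier_le_subset_eq continuous_subtype_val continuous_const) ht
    have h := ProbabilityMeasure.tendsto_measure_of_null_frontier_of_tendsto'
      (tendsto_id (x := 𝓝 ξ)) hfr
    have h' := (ENNReal.tendsto_toReal (measure_ne_top _ _)).comp h
    have h'' := (h'.sub_const ((ofProbabilityMeasure ξ).cdf t)).abs
    have hz : |((ξ : Measure unitInterval) {s : unitInterval | (s : ℝ) ≤ t}).toReal
        - (ofProbabilityMeasure ξ).cdf t| = 0 := by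
      rw [abs_eq_zero, sub_eq_zero]
      rfl
    rw [hz] at h''
    exact h''

/-- The weak topology agrees with the topology of the Wasserstein metric. -/
def homeo : ProbabilityMeasure unitInterval ≃ₜ ProbI :=
  continuous_ofProbabilityMeasure.homeoOfEquivCompactToT2

instance : CompactSpace ProbI := homeo.compactSpace

theorem continuous_integral (f : C(unitInterval, ℝ)) :
    Continuous fun ξ : ProbI => ∫ s, f s ∂ξ.toMeasure :=
  (ProbabilityMeasure.continuous_integral_continuousMap f).comp homeo.symm.continuous

theorem continuous_of_forall_integral {X : Type*} [TopologicalSpace X] {ξ : X → ProbI}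
    (h : ∀ f : C(unitInterval, ℝ), Continuous fun p => ∫ s, f s ∂(ξ p).toMeasure) :
    Continuous ξ := by
  have : Continuous fun p => homeo.symm (ξ p) :=
    ProbabilityMeasure.continuous_iff_forall_continuousMap_continuous_integral.2 h
  exact homeo.continuous.comp this

theorem eq_of_forall_integral {ξ η : ProbI}
    (h : ∀ f : C(unitInterval, ℝ), ∫ s, f s ∂ξ.toMeasure = ∫ s, f s ∂η.toMeasure) : ξ = η :=
  ext_toMeasure <| ext_of_forall_integral_eq_of_IsFiniteMeasure fun f => h f.toContinuousMap

/-- Closed sets form a generating π-system, and the measure of a closed set is a limit of integrals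
of bounded continuous functions, each continuous in the parameter. -/
theorem measurable_toMeasure {X : Type*} [TopologicalSpace X] [MeasurableSpace X]
    [OpensMeasurableSpace X] {ξ : X → ProbI} (hξ : Continuous ξ) :
    Measurable fun p => (ξ p).toMeasure := by
  have hgen : (inferInstance : MeasurableSpace unitInterval)
      = MeasurableSpace.generateFrom {F : Set unitInterval | IsClosed F} :=
    (BorelSpace.measurable_eq (α := unitInterval)).trans borel_eq_generateFrom_isClosed
  refine Measurable.measure_of_isPiSystem_of_isProbabilityMeasure hgen isPiSystem_isClosed ?_
  intro F hF
  refine measurable_of_tendsto_metrizable (f := fun n p => ∫⁻ s, hF.apprSeq n s ∂(ξ p).toMeasure)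
    (fun n => ?_) (tendsto_pi_nhds.2 fun p =>
      HasOuterApproxClosed.tendsto_lintegral_apprSeq hF (ξ p).toMeasure)
  exact ((ProbabilityMeasure.continuous_lintegral_boundedContinuousFunction
    (hF.apprSeq n)).comp (homeo.symm.continuous.comp hξ)).measurable

theorem integral_mix {α : Type*} [MeasurableSpace α] (ρ : Measure α) [IsProbabilityMeasure ρ]
    {ξ : α → ProbI} (h : Measurable fun a => (ξ a).toMeasure) (f : C(unitInterval, ℝ)) :
    ∫ s, f s ∂(mix ρ ξ h).toMeasure = ∫ a, ∫ s, f s ∂(ξ a).toMeasure ∂ρ := by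
  have hc : (mix ρ ξ h).toMeasure = (kernel ξ h ∘ₖ Kernel.const Unit ρ) () :=
    Measure.comp_eq_comp_const_apply (κ := kernel ξ h)
  have hf : Integrable f (mix ρ ξ h).toMeasure :=
    f.continuous.integrable_of_hasCompactSupport (HasCompactSupport.of_compactSpace f)
  rw [hc] at hf ⊢
  rw [Kernel.integral_comp hf]
  rfl

end ProbI
end

noncomputable section

open scoped BoundedContinuousFunction

/-! ### The transition operator of the urn -/

namespace Quadrant

instance : MeasurableSpace Quadrant :=
  inferInstanceAs (MeasurableSpace {p : ℝ × ℝ // 0 ≤ p.1 ∧ 0 ≤ p.2 ∧ p ≠ (0, 0)})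

instance : BorelSpace Quadrant :=
  inferInstanceAs (BorelSpace {p : ℝ × ℝ // 0 ≤ p.1 ∧ 0 ≤ p.2 ∧ p ≠ (0, 0)})

instance : SecondCountableTopology Quadrant :=
  inferInstanceAs (SecondCountableTopology {p : ℝ × ℝ // 0 ≤ p.1 ∧ 0 ≤ p.2 ∧ p ≠ (0, 0)})

theorem continuous_x : Continuous x := continuous_fst.comp continuous_subtype_val

theorem continuous_y : Continuous y := continuous_snd.comp continuous_subtype_val

/-- The total mass `x + y`. -/
def height (p : Quadrant) : ℝ := p.x + p.y

theorem height_pos (p : Quadrant) : 0 < p.height := p.sum_pos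

theorem continuous_height : Continuous height := continuous_x.add continuous_y

theorem coe_ratio (p : Quadrant) : (p.ratio : ℝ) = p.x / p.height := rfl

theorem continuous_ratio : Continuous ratio :=
  Continuous.subtype_mk (continuous_x.div continuous_height fun p => p.height_pos.ne') _

variable {β : ℝ}

theorem x_shiftX (p : Quadrant) (k : Set.Icc (0 : ℝ) β) : (p.shiftX k).x = p.x + k := rfl
theorem y_shiftX (p : Quadrant) (k : Set.Icc (0 : ℝ) β) : (p.shiftX k).y = p.y := rfl
theorem x_shiftY (p : Quadrant) (k : Set.Icc (0 : ℝ) β) : (p.shiftY k).x = p.x := rfl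
theorem y_shiftY (p : Quadrant) (k : Set.Icc (0 : ℝ) β) : (p.shiftY k).y = p.y + k := rfl

theorem height_shiftX (p : Quadrant) (k : Set.Icc (0 : ℝ) β) :
    (p.shiftX k).height = p.height + k := by
  simp only [height, x_shiftX, y_shiftX]
  ring

theorem height_shiftY (p : Quadrant) (k : Set.Icc (0 : ℝ) β) :
    (p.shiftY k).height = p.height + k := by
  simp only [height, x_shiftY, y_shiftY]
  ring

theorem continuous_shiftX :
    Continuous fun q : Quadrant × Set.Icc (0 : ℝ) β => q.1.shiftX q.2 :=
  Continuous.subtype_mk (((continuous_x.comp continuous_fst).add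
    (continuous_subtype_val.comp continuous_snd)).prodMk (continuous_y.comp continuous_fst)) _

theorem continuous_shiftY :
    Continuous fun q : Quadrant × Set.Icc (0 : ℝ) β => q.1.shiftY q.2 :=
  Continuous.subtype_mk ((continuous_x.comp continuous_fst).prodMk
    ((continuous_y.comp continuous_fst).add (continuous_subtype_val.comp continuous_snd))) _

theorem continuous_shiftX_right (p : Quadrant) :
    Continuous fun k : Set.Icc (0 : ℝ) β => p.shiftX k :=
  continuous_shiftX.comp (Continuous.prodMk_right p)

theorem continuous_shiftY_right (p : Quadrant) :
    Continuous fun k : Set.Icc (0 : ℝ) β => p.shiftY k :=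
  continuous_shiftY.comp (Continuous.prodMk_right p)

end Quadrant

open Quadrant

variable {β : ℝ} (μ ν : ProbabilityMeasure (Set.Icc (0 : ℝ) β))

/-- The expectation of `g` after one draw from `p`. -/
def stepAt (g : Quadrant → ℝ) (p : Quadrant) : ℝ :=
  p.ratio * ∫ k, g (p.shiftX k) ∂(μ : Measure (Set.Icc (0 : ℝ) β)) +
    (1 - p.ratio) * ∫ k, g (p.shiftY k) ∂(ν : Measure (Set.Icc (0 : ℝ) β))

theorem integrable_of_continuous_compact {X : Type*} [TopologicalSpace X] [CompactSpace X]
    [MeasurableSpace X] [OpensMeasurableSpace X] (ρ : Measure X) [IsFiniteMeasure ρ] {f : X → ℝ}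
    (hf : Continuous f) : Integrable f ρ :=
  hf.integrable_of_hasCompactSupport (HasCompactSupport.of_compactSpace f)

/-- The Feller property, by dominated convergence. It allows the transition operator to be iterated
on bounded continuous functions. -/
theorem continuous_stepAt {g : Quadrant → ℝ} (hg : Continuous g) {C : ℝ}
    (hC : ∀ p, |g p| ≤ C) : Continuous (stepAt μ ν g) := by
  have h1 : Continuous fun p : Quadrant =>
      ∫ k, g (p.shiftX k) ∂(μ : Measure (Set.Icc (0 : ℝ) β)) :=
    continuous_of_dominated (bound := fun _ => C)
      (fun p => (hg.comp p.continuous_shiftX_right).aestronglyMeasurable)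
      (fun p => Eventually.of_forall fun k => hC (p.shiftX k)) (integrable_const C)
      (Eventually.of_forall fun k => hg.comp (continuous_shiftX.comp (Continuous.prodMk_left k)))
  have h2 : Continuous fun p : Quadrant =>
      ∫ k, g (p.shiftY k) ∂(ν : Measure (Set.Icc (0 : ℝ) β)) :=
    continuous_of_dominated (bound := fun _ => C)
      (fun p => (hg.comp p.continuous_shiftY_right).aestronglyMeasurable)
      (fun p => Eventually.of_forall fun k => hC (p.shiftY k)) (integrable_const C)
      (Eventually.of_forall fun k => hg.comp (continuous_shiftY.comp (Continuous.prodMk_left k)))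
  have hr : Continuous fun p : Quadrant => (p.ratio : ℝ) :=
    continuous_subtype_val.comp continuous_ratio
  exact (hr.mul h1).add ((continuous_const.sub hr).mul h2)

theorem abs_stepAt_le {g : Quadrant → ℝ} {C : ℝ} (hC : ∀ p, |g p| ≤ C) (p : Quadrant) :
    |stepAt μ ν g p| ≤ C := by
  have h1 : ‖∫ k, g (p.shiftX k) ∂(μ : Measure (Set.Icc (0 : ℝ) β))‖ ≤ C := by
    simpa using norm_integral_le_of_norm_le_const (μ := (μ : Measure (Set.Icc (0 : ℝ) β)))
      (f := fun k => g (p.shiftX k)) (Eventually.of_forall fun k => hC (p.shiftX k))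
  have h2 : ‖∫ k, g (p.shiftY k) ∂(ν : Measure (Set.Icc (0 : ℝ) β))‖ ≤ C := by
    simpa using norm_integral_le_of_norm_le_const (μ := (ν : Measure (Set.Icc (0 : ℝ) β)))
      (f := fun k => g (p.shiftY k)) (Eventually.of_forall fun k => hC (p.shiftY k))
  have h3 := p.ratio.2.1
  have h4 := p.ratio.2.2
  rw [Real.norm_eq_abs, abs_le] at h1 h2
  rw [stepAt, abs_le]
  constructor <;> nlinarith

/-- The transition operator of the urn on bounded continuous functions. -/
def stepOp (g : Quadrant →ᵇ ℝ) : Quadrant →ᵇ ℝ :=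
  BoundedContinuousFunction.ofNormedAddCommGroup (stepAt μ ν g)
    (continuous_stepAt μ ν g.continuous fun p => g.norm_coe_le_norm p) ‖g‖
    (abs_stepAt_le μ ν fun p => g.norm_coe_le_norm p)

theorem stepOp_apply (g : Quadrant →ᵇ ℝ) (p : Quadrant) : stepOp μ ν g p = stepAt μ ν g p := rfl

/-! ### The Lyapunov function of the urn -/

variable {μ ν}

/-- An affine majorant in the increment $k$ integrates to an expression in the mean alone; this is
how the equality of the means enters. -/
theorem integral_le_of_affine {m : ℝ}
    (hμ : ∫ k, (k : ℝ) ∂(μ : Measure (Set.Icc (0 : ℝ) β)) = m) {f : Set.Icc (0 : ℝ) β → ℝ}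
    (hf : Continuous f) {b c : ℝ} (h : ∀ k, f k ≤ b + c * k) :
    ∫ k, f k ∂(μ : Measure (Set.Icc (0 : ℝ) β)) ≤ b + c * m := by
  have hk : Integrable (fun k : Set.Icc (0 : ℝ) β => (k : ℝ)) (μ : Measure _) :=
    integrable_of_continuous_compact _ continuous_subtype_val
  calc ∫ k, f k ∂(μ : Measure (Set.Icc (0 : ℝ) β))
      ≤ ∫ k, (b + c * k) ∂(μ : Measure (Set.Icc (0 : ℝ) β)) :=
        integral_mono (integrable_of_continuous_compact _ hf)
          ((integrable_const b).add (hk.const_mul c)) h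
    _ = b + c * m := by
        rw [integral_add (integrable_const b) (hk.const_mul c), integral_const_mul, hμ]
        simp

/-- The Lyapunov function `(R - a)² + B / s`, truncated at height `ε`. -/
def lyapunov (ε B a : ℝ) (p : Quadrant) : ℝ := (p.ratio - a) ^ 2 + B / max ε p.height

/-- The truncation at $\varepsilon$ keeps the function continuous and bounded near the origin; along
the urn it is inactive, since the mass never decreases. Continuity is joint in $a$ because a random
variable will be substituted for $a$. -/
theorem continuous_uncurry_lyapunov {ε : ℝ} (hε : 0 < ε) (B : ℝ) :
    Continuous fun q : ℝ × Quadrant => lyapunov ε B q.1 q.2 := by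
  refine (((continuous_subtype_val.comp (continuous_ratio.comp continuous_snd)).sub
    continuous_fst).pow 2).add (continuous_const.div
      (continuous_const.max (continuous_height.comp continuous_snd)) fun q => ?_)
  exact (lt_max_of_lt_left hε).ne'

theorem lyapunov_nonneg {ε B : ℝ} (hε : 0 < ε) (hB : 0 ≤ B) (a : ℝ) (p : Quadrant) :
    0 ≤ lyapunov ε B a p :=
  add_nonneg (sq_nonneg _) (div_nonneg hB (lt_max_of_lt_left hε).le)

theorem lyapunov_le {ε B a : ℝ} (hε : 0 < ε) (hB : 0 ≤ B) (ha : a ∈ Set.Icc (0 : ℝ) 1)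
    (p : Quadrant) : lyapunov ε B a p ≤ 1 + B / ε := by
  refine add_le_add ?_ (div_le_div_of_nonneg_left hB hε (le_max_left _ _))
  rw [sq_le_one_iff_abs_le_one]
  exact abs_le.2 ⟨by linarith [p.ratio.2.1, ha.2], by linarith [p.ratio.2.2, ha.1]⟩

/-- A draw of size $k$ changes the proportion by $kw/(s(s+k))$, where $w=y$ for a black ball and
$w=-x$ for a white one; here $c$ and $u$ are the old and new values of $R-a$. The bound is made
affine in $k$: the constant 3 collects two units from linearizing the cross term and one from the
square of the increment. -/
theorem sq_add_div_shift_le {β s k u w c B : ℝ} (hs : 0 < s) (hk : 0 ≤ k) (hkβ : k ≤ β)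
    (hw : |w| ≤ s) (hc : |c| ≤ 1) (hB : 0 ≤ B) (hu : u = c + k * w / (s * (s + k))) :
    u ^ 2 + B / (s + k) ≤ (c ^ 2 + 3 * (β ^ 2 / (s * (s + β))) + B / s) +
      (2 * c * (w / s ^ 2) - B / (s * (s + β))) * k := by
  have hβ : 0 ≤ β := hk.trans hkβ
  have hsk : 0 < s + k := by linarith
  have hsβ : 0 < s + β := by linarith
  -- The function $k\mapsto k^2/(s+k)$ is increasing on $[0,\beta]$.
  have hD : k ^ 2 / (s * (s + k)) ≤ β ^ 2 / (s * (s + β)) := by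
    rw [div_le_div_iff₀ (by positivity) (by positivity)]
    have h1 : k ^ 2 * (s + β) ≤ β ^ 2 * (s + k) := by
      have h2 : k ^ 2 ≤ β ^ 2 := by gcongr
      have h3 : k * (k * β) ≤ β * (k * β) := by gcongr
      nlinarith
    calc k ^ 2 * (s * (s + β)) = s * (k ^ 2 * (s + β)) := by ring
      _ ≤ s * (β ^ 2 * (s + k)) := by gcongr
      _ = _ := by ring
  have hB' : B / (s + k) ≤ B / s - B / (s * (s + β)) * k := by
    have e : B / s - B / (s + k) = B * (k / (s * (s + k))) := by
      field_simp
      ring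
    have h1 : k / (s * (s + β)) ≤ k / (s * (s + k)) := by gcongr
    have h2 : B / (s * (s + β)) * k = B * (k / (s * (s + β))) := by ring
    have h3 := mul_le_mul_of_nonneg_left h1 hB
    linarith
  have hsq : (k * w / (s * (s + k))) ^ 2 ≤ k ^ 2 / (s * (s + k)) := by
    have hw2 : w ^ 2 ≤ s ^ 2 := sq_le_sq.2 (by rwa [abs_of_pos hs])
    rw [div_pow, div_le_div_iff₀ (by positivity) (by positivity)]
    have : w ^ 2 * (s * (s + k)) ≤ (s * (s + k)) ^ 2 := by
      calc w ^ 2 * (s * (s + k)) ≤ s ^ 2 * (s * (s + k)) := by gcongr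
        _ = s * s * (s * (s + k)) := by ring
        _ ≤ s * (s + k) * (s * (s + k)) := by gcongr; linarith
        _ = _ := by ring
    calc (k * w) ^ 2 * (s * (s + k)) = k ^ 2 * (w ^ 2 * (s * (s + k))) := by ring
      _ ≤ _ := by gcongr
  -- Replacing $s+k$ by $s$ in the denominator leaves the error $2(-cw/s)\,k^2/(s(s+k))$, and
  -- $|cw|\le s$.
  have hlin : 2 * c * (k * w / (s * (s + k))) ≤
      2 * c * (w / s ^ 2) * k + 2 * (k ^ 2 / (s * (s + k))) := by
    have e : 2 * c * (k * w / (s * (s + k))) - 2 * c * (w / s ^ 2) * k =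
        2 * ((-(c * w) / s) * (k ^ 2 / (s * (s + k)))) := by
      field_simp
      ring
    have h1 : -(c * w) / s ≤ 1 := by
      rw [div_le_one hs]
      have : |c * w| ≤ 1 * s := by
        rw [abs_mul]
        exact mul_le_mul hc hw (abs_nonneg _) zero_le_one
      linarith [neg_le_abs (c * w)]
    have h2 : (-(c * w) / s) * (k ^ 2 / (s * (s + k))) ≤ 1 * (k ^ 2 / (s * (s + k))) := by
      gcongr
    linarith
  rw [hu]
  have e : (c + k * w / (s * (s + k))) ^ 2 =
    c ^ 2 + 2 * c * (k * w / (s * (s + k))) + (k * w / (s * (s + k))) ^ 2 := by ring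
  rw [e]
  linarith

theorem ratio_shiftX (p : Quadrant) (k : Set.Icc (0 : ℝ) β) :
    ((p.shiftX k).ratio : ℝ) = p.ratio + k * p.y / (p.height * (p.height + k)) := by
  have h1 := p.height_pos
  have h2 : 0 < p.height + k := by linarith [k.2.1]
  rw [coe_ratio, coe_ratio, height_shiftX, x_shiftX]
  field_simp
  simp only [height]
  ring

theorem ratio_shiftY (p : Quadrant) (k : Set.Icc (0 : ℝ) β) :
    ((p.shiftY k).ratio : ℝ) = p.ratio + k * (-p.x) / (p.height * (p.height + k)) := by
  have h1 := p.height_pos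
  have h2 : 0 < p.height + k := by linarith [k.2.1]
  rw [coe_ratio, coe_ratio, height_shiftY, x_shiftY]
  field_simp
  ring

/-- The Lyapunov function decreases in the mean. -/
theorem stepAt_lyapunov_le {m B ε a : ℝ}
    (hμ : ∫ k, (k : ℝ) ∂(μ : Measure (Set.Icc (0 : ℝ) β)) = m)
    (hν : ∫ k, (k : ℝ) ∂(ν : Measure (Set.Icc (0 : ℝ) β)) = m)
    (hB : 0 ≤ B) (hBm : B * m = 3 * β ^ 2 + 1) (hε : 0 < ε) (ha : a ∈ Set.Icc (0 : ℝ) 1)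
    {p : Quadrant} (hp : ε ≤ p.height) :
    stepAt μ ν (lyapunov ε B a) p ≤ lyapunov ε B a p - 1 / (p.height * (p.height + β)) := by
  have hcont : Continuous (lyapunov ε B a) :=
    (continuous_uncurry_lyapunov hε B).comp (Continuous.prodMk_right a)
  have hs := p.height_pos
  have hβ : 0 ≤ β := by
    obtain ⟨k⟩ := μ.nonempty
    exact k.2.1.trans k.2.2
  have hc : |(p.ratio : ℝ) - a| ≤ 1 :=
    abs_le.2 ⟨by linarith [p.ratio.2.1, ha.2], by linarith [p.ratio.2.2, ha.1]⟩
  have hx : |(-p.x)| ≤ p.height := by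
    rw [abs_neg, abs_of_nonneg p.x_nonneg, height]
    linarith [p.y_nonneg]
  have hy : |p.y| ≤ p.height := by
    rw [abs_of_nonneg p.y_nonneg, height]
    linarith [p.x_nonneg]
  have hX := integral_le_of_affine hμ (hcont.comp (p.continuous_shiftX_right))
    (b := ((p.ratio : ℝ) - a) ^ 2 + 3 * (β ^ 2 / (p.height * (p.height + β))) + B / p.height)
    (c := 2 * ((p.ratio : ℝ) - a) * (p.y / p.height ^ 2) - B / (p.height * (p.height + β)))
    fun k => by
      have hmax : max ε (p.height + k) = p.height + k := max_eq_right (by linarith [k.2.1])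
      simp only [Function.comp, lyapunov, height_shiftX, hmax]
      exact sq_add_div_shift_le hs k.2.1 k.2.2 hy hc hB (by rw [ratio_shiftX]; ring)
  have hY := integral_le_of_affine hν (hcont.comp (p.continuous_shiftY_right))
    (b := ((p.ratio : ℝ) - a) ^ 2 + 3 * (β ^ 2 / (p.height * (p.height + β))) + B / p.height)
    (c := 2 * ((p.ratio : ℝ) - a) * (-p.x / p.height ^ 2) - B / (p.height * (p.height + β)))
    fun k => by
      have hmax : max ε (p.height + k) = p.height + k := max_eq_right (by linarith [k.2.1])
      simp only [Function.comp, lyapunov, height_shiftY, hmax]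
      exact sq_add_div_shift_le hs k.2.1 k.2.2 hx hc hB (by rw [ratio_shiftY]; ring)
  have hr0 := p.ratio.2.1
  have hr1 : 0 ≤ 1 - (p.ratio : ℝ) := by linarith [p.ratio.2.2]
  refine (add_le_add (mul_le_mul_of_nonneg_left hX hr0)
    (mul_le_mul_of_nonneg_left hY hr1)).trans (le_of_eq ?_)
  have hmax : max ε p.height = p.height := max_eq_right hp
  -- The terms linear in $R-a$ carry $y$ with probability $x/s$ and $-x$ with probability $y/s$,
  -- both times the same mean $m$, so they cancel.
  have hrx : (p.ratio : ℝ) * p.y + (1 - p.ratio) * (-p.x) = 0 := by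
    rw [coe_ratio]
    field_simp
    simp only [height]
    ring
  simp only [lyapunov, hmax]
  set r : ℝ := (p.ratio : ℝ)
  set s := p.height
  -- What survives is $(3\beta^2-Bm)/(s(s+\beta))$; the choice of $B$ makes the numerator $-1$.
  calc _ = (r - a) ^ 2 + B / s + (3 * β ^ 2 - B * m) / (s * (s + β)) +
        2 * (r - a) * m / s ^ 2 * (r * p.y + (1 - r) * (-p.x)) := by ring
    _ = _ := by
        rw [hrx, hBm]
        ring
end

noncomputable section

open scoped BoundedContinuousFunction
open Quadrant

/-! ### The quantile transform -/

section Quantile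

variable {β : ℝ} (μ : ProbabilityMeasure (Set.Icc (0 : ℝ) β))

theorem real_coe_le_eq_cdf (z : ℝ) :
    (μ : Measure (Set.Icc (0 : ℝ) β)).real {k | (k : ℝ) ≤ z} =
      ProbabilityTheory.cdf ((μ : Measure (Set.Icc (0 : ℝ) β)).map Subtype.val) z := by
  have : IsProbabilityMeasure ((μ : Measure (Set.Icc (0 : ℝ) β)).map (Subtype.val)) :=
    Measure.isProbabilityMeasure_map measurable_subtype_coe.aemeasurable
  rw [ProbabilityTheory.cdf_eq_real, map_measureReal_apply measurable_subtype_coe measurableSet_Iic]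
  rfl

/-- The quantile function and the distribution function form a Galois connection; the infimum is
attained because the distribution function is right-continuous. -/
theorem quantile_le_iff (t : unitInterval) (z : Set.Icc (0 : ℝ) β) :
    quantile μ t ≤ z ↔ (t : ℝ) ≤ (μ : Measure (Set.Icc (0 : ℝ) β)).real {k | (k : ℝ) ≤ z} := by
  constructor
  · intro h
    have hle : sInf {z : ℝ | z ∈ Set.Icc (0 : ℝ) β ∧
      (t : ℝ) ≤ (μ : Measure (Set.Icc (0 : ℝ) β)).real {k | (k : ℝ) ≤ z}} ≤ z := h
    have hne : {z : ℝ | z ∈ Set.Icc (0 : ℝ) β ∧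
        (t : ℝ) ≤ (μ : Measure (Set.Icc (0 : ℝ) β)).real {k | (k : ℝ) ≤ z}}.Nonempty := by
      refine ⟨β, ⟨z.2.1.trans z.2.2, le_rfl⟩, ?_⟩
      have huniv : {k : Set.Icc (0 : ℝ) β | (k : ℝ) ≤ β} = Set.univ :=
        Set.eq_univ_of_forall fun k => k.2.2
      rw [huniv, probReal_univ]
      exact t.2.2
    have key : ∀ z' : ℝ, z < z' → (t : ℝ) ≤
        ProbabilityTheory.cdf ((μ : Measure (Set.Icc (0 : ℝ) β)).map Subtype.val) z' := by
      intro z' hz'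
      obtain ⟨w, hw, hwz⟩ := exists_lt_of_csInf_lt hne (hle.trans_lt hz')
      rw [← real_coe_le_eq_cdf]
      exact hw.2.trans (measureReal_mono fun k hk => le_trans hk hwz.le)
    rw [real_coe_le_eq_cdf]
    have hc := (StieltjesFunction.right_continuous
      (ProbabilityTheory.cdf ((μ : Measure (Set.Icc (0 : ℝ) β)).map Subtype.val)) (z : ℝ)).mono
      Set.Ioi_subset_Ici_self
    exact ge_of_tendsto hc.tendsto (eventually_mem_nhdsWithin.mono key)
  · intro h
    exact csInf_le (s := {z : ℝ | z ∈ Set.Icc (0 : ℝ) β ∧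
      (t : ℝ) ≤ (μ : Measure (Set.Icc (0 : ℝ) β)).real {k | (k : ℝ) ≤ z}})
      ⟨0, fun w hw => hw.1.1⟩ ⟨z.2, h⟩

theorem monotone_quantile : Monotone (quantile μ) := fun s t hst =>
  (quantile_le_iff μ s _).2 (le_trans (Subtype.coe_le_coe.2 hst) ((quantile_le_iff μ t _).1 le_rfl))

theorem measurable_quantile : Measurable (quantile μ) := (monotone_quantile μ).measurable

/-- The quantile transform of a uniform variable. -/
theorem map_quantile : (volume : Measure unitInterval).map (quantile μ) = μ := by
  have : IsProbabilityMeasure ((volume : Measure unitInterval).map (quantile μ)) :=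
    Measure.isProbabilityMeasure_map (measurable_quantile μ).aemeasurable
  refine Measure.ext_of_Iic _ _ fun z => ?_
  rw [Measure.map_apply (measurable_quantile μ) measurableSet_Iic]
  -- By the Galois connection the preimage is an initial interval with endpoint $\mu([0,z])$, and
  -- its uniform measure is that endpoint.
  have h : quantile μ ⁻¹' Set.Iic z = Set.Iic
      (⟨(μ : Measure (Set.Icc (0 : ℝ) β)).real {k | (k : ℝ) ≤ z}, measureReal_nonneg,
        measureReal_le_one⟩ : unitInterval) := by
    ext t
    exact quantile_le_iff μ t z
  rw [h, unitInterval.volume_Iic]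
  exact ENNReal.ofReal_toReal (measure_ne_top _ _)

end Quantile

/-! ### One draw from the urn -/

section Draw

variable {β : ℝ} (μ ν : ProbabilityMeasure (Set.Icc (0 : ℝ) β))

/-- The composition after one draw from `p` with noise `(u, (v, w))`. -/
def draw (p : Quadrant) (n : unitInterval × unitInterval × unitInterval) : Quadrant :=
  if n.1 ≤ p.ratio then p.shiftX (quantile μ n.2.1) else p.shiftY (quantile ν n.2.2)

theorem measurable_draw :
    Measurable fun q : Quadrant × unitInterval × unitInterval × unitInterval =>
      draw μ ν q.1 q.2 := by
  refine Measurable.ite (measurableSet_le measurable_snd.fst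
    (continuous_ratio.measurable.comp measurable_fst)) ?_ ?_
  · exact continuous_shiftX.measurable.comp (measurable_fst.prodMk
      ((measurable_quantile μ).comp measurable_snd.snd.fst))
  · exact continuous_shiftY.measurable.comp (measurable_fst.prodMk
      ((measurable_quantile ν).comp measurable_snd.snd.snd))

theorem urn_succ_eq_draw {Ω : Type*} (U V W : ℕ → Ω → unitInterval) (p : Quadrant) (ω : Ω) (n : ℕ) :
    urn μ ν U V W p ω (n + 1) = draw μ ν (urn μ ν U V W p ω n) (U n ω, V n ω, W n ω) := rfl

/-- A draw uses only one component of $(v,w)$, and $u$, which is independent of the pair, decides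
which. Hence only the marginals of `κ` matter, not the dependence between $v$ and $w$. -/
theorem integral_draw (κ : Measure (unitInterval × unitInterval)) [IsProbabilityMeasure κ]
    (h1 : κ.map Prod.fst = volume) (h2 : κ.map Prod.snd = volume) {g : Quadrant → ℝ}
    (hg : Measurable g) {C : ℝ} (hC : ∀ p, |g p| ≤ C) (p : Quadrant) :
    ∫ n, g (draw μ ν p n) ∂((volume : Measure unitInterval).prod κ) = stepAt μ ν g p := by
  set a : unitInterval × unitInterval → ℝ := fun v => g (p.shiftX (quantile μ v.1))
  set b : unitInterval × unitInterval → ℝ := fun v => g (p.shiftY (quantile ν v.2))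
  have hgX : Measurable fun k : Set.Icc (0 : ℝ) β => g (p.shiftX k) :=
    hg.comp p.continuous_shiftX_right.measurable
  have hgY : Measurable fun k : Set.Icc (0 : ℝ) β => g (p.shiftY k) :=
    hg.comp p.continuous_shiftY_right.measurable
  have hgX' : Measurable fun v : unitInterval => g (p.shiftX (quantile μ v)) :=
    hgX.comp (measurable_quantile μ)
  have hgY' : Measurable fun v : unitInterval => g (p.shiftY (quantile ν v)) :=
    hgY.comp (measurable_quantile ν)
  have ha : ∫ v, a v ∂κ = ∫ k, g (p.shiftX k) ∂(μ : Measure (Set.Icc (0 : ℝ) β)) := by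
    rw [← map_quantile μ, integral_map (measurable_quantile μ).aemeasurable
      hgX.aestronglyMeasurable, ← h1, integral_map measurable_fst.aemeasurable
      hgX'.aestronglyMeasurable]
  have hb : ∫ v, b v ∂κ = ∫ k, g (p.shiftY k) ∂(ν : Measure (Set.Icc (0 : ℝ) β)) := by
    rw [← map_quantile ν, integral_map (measurable_quantile ν).aemeasurable
      hgY.aestronglyMeasurable, ← h2, integral_map measurable_snd.aemeasurable
      hgY'.aestronglyMeasurable]
  have hai : Integrable a κ := Integrable.of_bound
    (hgX'.comp measurable_fst).aestronglyMeasurable C (Eventually.of_forall fun v => hC _)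
  have hbi : Integrable b κ := Integrable.of_bound
    (hgY'.comp measurable_snd).aestronglyMeasurable C (Eventually.of_forall fun v => hC _)
  -- Each summand is a function of $u$ times a function of $(v,w)$, so its integral factors.
  have hsplit : ∀ n : unitInterval × unitInterval × unitInterval, g (draw μ ν p n) =
      (Set.Iic p.ratio).indicator (fun _ => (1 : ℝ)) n.1 * a n.2 +
      (Set.Ioi p.ratio).indicator (fun _ => (1 : ℝ)) n.1 * b n.2 := by
    intro n
    by_cases h : n.1 ≤ p.ratio
    · simp [draw, h, a, Set.indicator]
    · simp [draw, h, b, Set.indicator, not_le.1 h]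
  have hi1 : Integrable ((Set.Iic p.ratio).indicator fun _ => (1 : ℝ)) volume :=
    (integrable_const 1).indicator measurableSet_Iic
  have hi2 : Integrable ((Set.Ioi p.ratio).indicator fun _ => (1 : ℝ)) volume :=
    (integrable_const 1).indicator measurableSet_Ioi
  simp only [hsplit]
  rw [integral_add (hi1.mul_prod hai) (hi2.mul_prod hbi), integral_prod_mul, integral_prod_mul,
    integral_indicator_const _ measurableSet_Iic, integral_indicator_const _ measurableSet_Ioi,
    ha, hb, stepAt, measureReal_def, measureReal_def, unitInterval.volume_Iic,
    unitInterval.volume_Ioi]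
  simp [ENNReal.toReal_ofReal, p.ratio.2.1, p.ratio.2.2]

end Draw

/-! ### Independence of the past and the next draw -/

/-- Merges two independent families that are independent of each other into one family, so that it
can be regrouped by time. A finite intersection splits into its left and its right indices. -/
theorem iIndep_sumElim {Ω ι κ : Type*} {mΩ : MeasurableSpace Ω} {P : Measure Ω}
    {m₁ : ι → MeasurableSpace Ω} {m₂ : κ → MeasurableSpace Ω} (h₁ : iIndep m₁ P)
    (h₂ : iIndep m₂ P) {M₁ M₂ : MeasurableSpace Ω} (hM₁ : ∀ i, m₁ i ≤ M₁) (hM₂ : ∀ j, m₂ j ≤ M₂)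
    (h : Indep M₁ M₂ P) : iIndep (Sum.elim m₁ m₂) P := by
  classical
  rw [iIndep_iff]
  intro s f hf
  have e : s = s.toLeft.disjSum s.toRight := Finset.toLeft_disjSum_toRight.symm
  have hf1 : ∀ i ∈ s.toLeft, MeasurableSet[m₁ i] (f (Sum.inl i)) := fun i hi =>
    hf _ (Finset.mem_toLeft.1 hi)
  have hf2 : ∀ j ∈ s.toRight, MeasurableSet[m₂ j] (f (Sum.inr j)) := fun j hj =>
    hf _ (Finset.mem_toRight.1 hj)
  have hinter : (⋂ i ∈ s, f i) =
      (⋂ i ∈ s.toLeft, f (Sum.inl i)) ∩ ⋂ j ∈ s.toRight, f (Sum.inr j) := by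
    ext ω
    simp [Sum.forall]
  have hm1 : MeasurableSet[M₁] (⋂ i ∈ s.toLeft, f (Sum.inl i)) :=
    Finset.measurableSet_biInter _ fun i hi => hM₁ i _ (hf1 i hi)
  have hm2 : MeasurableSet[M₂] (⋂ j ∈ s.toRight, f (Sum.inr j)) :=
    Finset.measurableSet_biInter _ fun j hj => hM₂ j _ (hf2 j hj)
  rw [hinter, (Indep_iff _ _ _).1 h _ _ hm1 hm2, h₁.meas_biInter hf1, h₂.meas_biInter hf2]
  conv_rhs => rw [e, Finset.prod_disjSum]

namespace IsUrnNoise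

variable {Ω : Type*} [mΩ : MeasurableSpace Ω] {P : Measure Ω} {U V W : ℕ → Ω → unitInterval}

/-- The σ-algebras generated by the single noise variables. -/
abbrev sigma (U V W : ℕ → Ω → unitInterval) : ℕ ⊕ ℕ → MeasurableSpace Ω :=
  Sum.elim (fun n => MeasurableSpace.comap (U n) inferInstance)
    (fun n => MeasurableSpace.comap (fun ω => (V n ω, W n ω)) inferInstance)

theorem sigma_le (h : IsUrnNoise P U V W) (i : ℕ ⊕ ℕ) : sigma U V W i ≤ mΩ := by
  cases i with
  | inl n => exact (h.measurable_U n).comap_le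
  | inr n => exact ((h.measurable_V n).prodMk (h.measurable_W n)).comap_le

theorem iIndep_sigma (h : IsUrnNoise P U V W) : iIndep (sigma U V W) P := by
  refine iIndep_sumElim h.indep_U.iIndep h.indep_VW.iIndep (fun n => ?_) (fun n => ?_)
    ((IndepFun_iff_Indep _ _ _).1 h.indep_U_VW)
  · exact Measurable.comap_le ((measurable_pi_apply n).comp
      (comap_measurable fun ω n => U n ω))
  · exact Measurable.comap_le ((measurable_pi_apply n).comp
      (comap_measurable fun ω n => (V n ω, W n ω)))

/-- The information available before draw `n`. -/
def history (h : IsUrnNoise P U V W) : Filtration ℕ mΩ where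
  -- The inequality is strict: the composition after $n$ draws depends on the noise with indices
  -- below $n$, which leaves the noise with index $n$ independent of `history n`.
  seq n := ⨆ i ∈ {i : ℕ ⊕ ℕ | Sum.elim id id i < n}, sigma U V W i
  mono' _ _ hmn := biSup_mono fun _ hi => lt_of_lt_of_le hi hmn
  le' _ := iSup₂_le fun i _ => h.sigma_le i

theorem sigma_le_history (h : IsUrnNoise P U V W) {n : ℕ} {i : ℕ ⊕ ℕ}
    (hi : Sum.elim id id i < n) : sigma U V W i ≤ h.history n :=
  le_biSup (fun i => sigma U V W i) (show i ∈ {i : ℕ ⊕ ℕ | Sum.elim id id i < n} from hi)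

theorem measurable_noise (h : IsUrnNoise P U V W) (n : ℕ) :
    Measurable fun ω => (U n ω, V n ω, W n ω) :=
  (h.measurable_U n).prodMk ((h.measurable_V n).prodMk (h.measurable_W n))

theorem measurable_noise_history (h : IsUrnNoise P U V W) (n : ℕ) :
    Measurable[h.history (n + 1)] fun ω => (U n ω, V n ω, W n ω) := by
  have h1 : Measurable[h.history (n + 1)] (U n) :=
    (comap_measurable (U n)).mono (h.sigma_le_history (i := Sum.inl n) (Nat.lt_succ_self n)) le_rfl
  have h2 : Measurable[h.history (n + 1)] fun ω => (V n ω, W n ω) :=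
    (comap_measurable fun ω => (V n ω, W n ω)).mono
      (h.sigma_le_history (i := Sum.inr n) (Nat.lt_succ_self n)) le_rfl
  exact h1.prodMk h2

/-- The index sets $\{i<n\}$ and $\{i=n\}$ are disjoint, so the σ-algebras they generate are
independent. -/
theorem indepFun_noise (h : IsUrnNoise P U V W) {γ : Type*} [MeasurableSpace γ] {n : ℕ}
    {Y : Ω → γ} (hY : Measurable[h.history n] Y) :
    IndepFun Y (fun ω => (U n ω, V n ω, W n ω)) P := by
  have hi := indep_iSup_of_disjoint h.sigma_le h.iIndep_sigma
    (S := {i : ℕ ⊕ ℕ | Sum.elim id id i < n}) (T := {i : ℕ ⊕ ℕ | Sum.elim id id i = n})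
    (Set.disjoint_left.2 fun i hi hi' => (ne_of_lt hi) hi')
  rw [IndepFun_iff_Indep]
  refine indep_of_indep_of_le_left (indep_of_indep_of_le_right hi ?_) hY.comap_le
  have h1 : Measurable[⨆ i ∈ {i : ℕ ⊕ ℕ | Sum.elim id id i = n}, sigma U V W i] (U n) :=
    (comap_measurable (U n)).mono (le_biSup (fun i => sigma U V W i)
      (show Sum.inl n ∈ {i : ℕ ⊕ ℕ | Sum.elim id id i = n} from rfl)) le_rfl
  have h2 : Measurable[⨆ i ∈ {i : ℕ ⊕ ℕ | Sum.elim id id i = n}, sigma U V W i]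
      fun ω => (V n ω, W n ω) :=
    (comap_measurable fun ω => (V n ω, W n ω)).mono (le_biSup (fun i => sigma U V W i)
      (show Sum.inr n ∈ {i : ℕ ⊕ ℕ | Sum.elim id id i = n} from rfl)) le_rfl
  exact Measurable.comap_le (h1.prodMk h2)

theorem map_noise [IsProbabilityMeasure P] (h : IsUrnNoise P U V W) (n : ℕ) :
    P.map (fun ω => (U n ω, V n ω, W n ω)) =
      (volume : Measure unitInterval).prod (P.map fun ω => (V n ω, W n ω)) := by
  have hi : IndepFun (U n) (fun ω => (V n ω, W n ω)) P :=
    h.indep_U_VW.comp (φ := fun f : ℕ → unitInterval => f n)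
      (ψ := fun f : ℕ → unitInterval × unitInterval => f n)
      (measurable_pi_apply n) (measurable_pi_apply n)
  rw [← h.law_U n]
  exact (indepFun_iff_map_prod_eq_prod_map_map (h.measurable_U n).aemeasurable
    ((h.measurable_V n).prodMk (h.measurable_W n)).aemeasurable).1 hi

/-! ### The Markov property of the urn -/

variable {β : ℝ} (μ ν : ProbabilityMeasure (Set.Icc (0 : ℝ) β))

theorem measurable_urn_history (h : IsUrnNoise P U V W) (p : Quadrant) (n : ℕ) :
    Measurable[h.history n] fun ω => urn μ ν U V W p ω n := by
  induction n with
  | zero => exact measurable_const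
  | succ n ih =>
    simp only [urn_succ_eq_draw]
    exact (measurable_draw μ ν).comp ((ih.mono (h.history.mono n.le_succ) le_rfl).prodMk
      (h.measurable_noise_history n))

theorem measurable_urn (h : IsUrnNoise P U V W) (p : Quadrant) (n : ℕ) :
    Measurable fun ω => urn μ ν U V W p ω n :=
  (h.measurable_urn_history μ ν p n).mono (h.history.le n) le_rfl

/-- The Markov property of the urn. -/
theorem integral_urn_succ [IsProbabilityMeasure P] (h : IsUrnNoise P U V W) (p : Quadrant) (n : ℕ)
    {γ : Type*} [MeasurableSpace γ] {Y : Ω → γ} (hY : Measurable[h.history n] Y)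
    {g : γ → Quadrant → ℝ} (hg : Measurable (Function.uncurry g)) {C : ℝ}
    (hC : ∀ c q, |g c q| ≤ C) :
    ∫ ω, g (Y ω) (urn μ ν U V W p ω (n + 1)) ∂P =
      ∫ ω, stepAt μ ν (g (Y ω)) (urn μ ν U V W p ω n) ∂P := by
  -- The pair of `Y` and the composition is independent of the next noise, so the joint law is a
  -- product and Fubini integrates the noise out. Carrying `Y` along does the work of a conditional
  -- expectation: it will be a past proportion or the indicator of a past event.
  have hH : Measurable[h.history n] fun ω => (Y ω, urn μ ν U V W p ω n) :=
    hY.prodMk (h.measurable_urn_history μ ν p n)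
  have hHm : Measurable fun ω => (Y ω, urn μ ν U V W p ω n) := hH.mono (h.history.le n) le_rfl
  have hVW := (h.measurable_V n).prodMk (h.measurable_W n)
  have hPH : IsProbabilityMeasure (P.map fun ω => (Y ω, urn μ ν U V W p ω n)) :=
    Measure.isProbabilityMeasure_map hHm.aemeasurable
  have hPV : IsProbabilityMeasure (P.map fun ω => (V n ω, W n ω)) :=
    Measure.isProbabilityMeasure_map hVW.aemeasurable
  have hlaw := (indepFun_iff_map_prod_eq_prod_map_map hHm.aemeasurable
    (h.measurable_noise n).aemeasurable).1 (h.indepFun_noise hH)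
  rw [h.map_noise n] at hlaw
  have hG : Measurable fun r : (γ × Quadrant) × unitInterval × unitInterval × unitInterval =>
      g r.1.1 (draw μ ν r.1.2 r.2) :=
    hg.comp (measurable_fst.fst.prodMk
      ((measurable_draw μ ν).comp (measurable_fst.snd.prodMk measurable_snd)))
  have e1 : ∫ ω, g (Y ω) (urn μ ν U V W p ω (n + 1)) ∂P =
      ∫ r, g r.1.1 (draw μ ν r.1.2 r.2) ∂(P.map fun ω =>
        ((Y ω, urn μ ν U V W p ω n), (U n ω, V n ω, W n ω))) :=
    (integral_map (hHm.prodMk (h.measurable_noise n)).aemeasurable hG.aestronglyMeasurable).symm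
  have h1 : (P.map fun ω => (V n ω, W n ω)).map Prod.fst = volume := by
    rw [Measure.map_map measurable_fst hVW]
    exact h.law_V n
  have h2 : (P.map fun ω => (V n ω, W n ω)).map Prod.snd = volume := by
    rw [Measure.map_map measurable_snd hVW]
    exact h.law_W n
  have hint : Integrable (fun r : (γ × Quadrant) × unitInterval × unitInterval × unitInterval =>
      g r.1.1 (draw μ ν r.1.2 r.2)) ((P.map fun ω => (Y ω, urn μ ν U V W p ω n)).prod
        ((volume : Measure unitInterval).prod (P.map fun ω => (V n ω, W n ω)))) :=
    Integrable.of_bound hG.aestronglyMeasurable C (Eventually.of_forall fun r => hC _ _)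
  have hin : ∀ c : γ × Quadrant, ∫ r, g c.1 (draw μ ν c.2 r)
      ∂((volume : Measure unitInterval).prod (P.map fun ω => (V n ω, W n ω))) =
      stepAt μ ν (g c.1) c.2 := fun c =>
    integral_draw μ ν _ h1 h2 (hg.comp measurable_prodMk_left) (hC c.1) c.2
  have hsm := hint.aestronglyMeasurable.integral_prod_right'
  rw [e1, hlaw, integral_prod _ hint]
  simp only [hin] at hsm ⊢
  exact integral_map hHm.aemeasurable hsm

/-- Expectations of the urn are iterates of the transition operator. -/
theorem integral_urn [IsProbabilityMeasure P] (h : IsUrnNoise P U V W) (p : Quadrant) (n : ℕ)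
    (g : Quadrant →ᵇ ℝ) :
    ∫ ω, g (urn μ ν U V W p ω n) ∂P = (stepOp μ ν)^[n] g p := by
  induction n generalizing g with
  | zero => simp [urn]
  | succ n ih =>
    rw [Function.iterate_succ_apply, ← ih (stepOp μ ν g)]
    exact h.integral_urn_succ μ ν p n (Y := fun _ => ()) measurable_const (g := fun _ => g)
      (g.continuous.measurable.comp measurable_snd) (C := ‖g‖) fun _ q => g.norm_coe_le_norm q

end IsUrnNoise
end

noncomputable section

open scoped BoundedContinuousFunction
open Quadrant

/-! ### Convergence of the urn -/

theorem lyapunov_eq {ε B a : ℝ} {p : Quadrant} :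
    lyapunov ε B a p = (p.ratio - a) ^ 2 + B * (max ε p.height)⁻¹ := by
  rw [lyapunov, div_eq_mul_inv]

theorem abs_lyapunov_le {ε B a : ℝ} (hε : 0 < ε) (hB : 0 ≤ B) (ha : a ∈ Set.Icc (0 : ℝ) 1)
    (p : Quadrant) : |lyapunov ε B a p| ≤ 1 + B / ε := by
  rw [abs_of_nonneg (lyapunov_nonneg hε hB a p)]
  exact lyapunov_le hε hB ha p

theorem measurable_uncurry_lyapunov {ε : ℝ} (hε : 0 < ε) (B : ℝ) :
    Measurable (Function.uncurry fun (a : unitInterval) q => lyapunov ε B a q) :=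
  ((continuous_uncurry_lyapunov hε B).comp
    ((continuous_subtype_val.comp continuous_fst).prodMk continuous_snd)).measurable

/-- The rate of decrease of the Lyapunov function. -/
def decayRate (β : ℝ) (p : Quadrant) : ℝ := 1 / (p.height * (p.height + β))

theorem measurable_decayRate (β : ℝ) : Measurable (decayRate β) :=
  ((continuous_height.measurable).mul (continuous_height.measurable.add_const β)).const_div 1

theorem decayRate_pos {β : ℝ} (hβ : 0 ≤ β) (p : Quadrant) : 0 < decayRate β p := by
  have := p.height_pos
  rw [decayRate]
  positivity

theorem decayRate_anti {β : ℝ} (hβ : 0 ≤ β) {p q : Quadrant} (h : p.height ≤ q.height) :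
    decayRate β q ≤ decayRate β p := by
  have hp := p.height_pos
  have hq := q.height_pos
  exact one_div_le_one_div_of_le (by positivity) (by gcongr)

/-- The inverse of the total mass, truncated at `1 / ε`. -/
def invHeight {ε : ℝ} (hε : 0 < ε) : Quadrant →ᵇ ℝ :=
  BoundedContinuousFunction.ofNormedAddCommGroup (fun p => (max ε p.height)⁻¹)
    ((continuous_const.max continuous_height).inv₀ fun p => (lt_max_of_lt_left hε).ne') ε⁻¹
    fun p => by
      rw [Real.norm_eq_abs, abs_of_nonneg (inv_nonneg.2 (lt_max_of_lt_left hε).le)]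
      exact inv_anti₀ hε (le_max_left _ _)

theorem invHeight_apply {ε : ℝ} (hε : 0 < ε) (p : Quadrant) :
    invHeight hε p = (max ε p.height)⁻¹ := rfl

theorem stepAt_const_mul {β : ℝ} (μ ν : ProbabilityMeasure (Set.Icc (0 : ℝ) β)) (c : ℝ)
    (g : Quadrant → ℝ) (p : Quadrant) :
    stepAt μ ν (fun q => c * g q) p = c * stepAt μ ν g p := by
  simp only [stepAt, integral_const_mul]
  ring

namespace IsUrnNoise

variable {Ω : Type*} [mΩ : MeasurableSpace Ω] {P : Measure Ω} {U V W : ℕ → Ω → unitInterval}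
  {β : ℝ} {μ ν : ProbabilityMeasure (Set.Icc (0 : ℝ) β)}

theorem _root_.monotone_height_urn {Ω : Type*} {β : ℝ}
    (μ ν : ProbabilityMeasure (Set.Icc (0 : ℝ) β)) (U V W : ℕ → Ω → unitInterval)
    (p : Quadrant) (ω : Ω) : Monotone fun n => (urn μ ν U V W p ω n).height := by
  refine monotone_nat_of_le_succ fun n => ?_
  rw [urn_succ_eq_draw, draw]
  split_ifs
  · rw [height_shiftX]
    exact le_add_of_nonneg_right (quantile μ _).2.1
  · rw [height_shiftY]
    exact le_add_of_nonneg_right (quantile ν _).2.1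

theorem _root_.height_le_height_urn {Ω : Type*} {β : ℝ}
    (μ ν : ProbabilityMeasure (Set.Icc (0 : ℝ) β)) (U V W : ℕ → Ω → unitInterval)
    (p : Quadrant) (ω : Ω) (n : ℕ) : p.height ≤ (urn μ ν U V W p ω n).height :=
  monotone_height_urn μ ν U V W p ω n.zero_le

theorem measurable_lyapunov {ε B : ℝ} (hε : 0 < ε) {p : Quadrant}
    (h : IsUrnNoise P U V W) {Y : Ω → unitInterval} (hY : Measurable Y) (n : ℕ) :
    Measurable fun ω => lyapunov ε B (Y ω) (urn μ ν U V W p ω n) := by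
  have hu := h.measurable_urn μ ν p n
  have hp := hY.prodMk hu
  have := (measurable_uncurry_lyapunov hε B).comp hp
  exact this

theorem measurable_ratio_urn (h : IsUrnNoise P U V W) (p : Quadrant) (n : ℕ) :
    Measurable fun ω => (urn μ ν U V W p ω n).ratio :=
  continuous_ratio.measurable.comp (h.measurable_urn μ ν p n)

variable [IsProbabilityMeasure P]

theorem integrable_lyapunov {ε B : ℝ} (hε : 0 < ε) (hB : 0 ≤ B) {p : Quadrant}
    (h : IsUrnNoise P U V W) {Y : Ω → unitInterval} (hY : Measurable Y) (n : ℕ) :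
    Integrable (fun ω => lyapunov ε B (Y ω) (urn μ ν U V W p ω n)) P :=
  Integrable.of_bound (h.measurable_lyapunov hε hY n).aestronglyMeasurable (1 + B / ε)
    (Eventually.of_forall fun ω => abs_lyapunov_le hε hB (Y ω).2 _)

theorem integrable_decayRate (hβ : 0 ≤ β) (p : Quadrant) (h : IsUrnNoise P U V W) (n : ℕ) :
    Integrable (fun ω => decayRate β (urn μ ν U V W p ω n)) P :=
  Integrable.of_bound ((measurable_decayRate β).comp
    (h.measurable_urn μ ν p n)).aestronglyMeasurable (decayRate β p)
    (Eventually.of_forall fun ω => by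
      rw [Real.norm_eq_abs, abs_of_pos (decayRate_pos hβ _)]
      exact decayRate_anti hβ (height_le_height_urn μ ν U V W p ω n))

/-- The integrated drift inequality, with a centre `Y` that is known before the draw in place of the
constant $a$. -/
theorem integral_lyapunov_succ_le {m B ε : ℝ}
    (hμ : ∫ k, (k : ℝ) ∂(μ : Measure (Set.Icc (0 : ℝ) β)) = m)
    (hν : ∫ k, (k : ℝ) ∂(ν : Measure (Set.Icc (0 : ℝ) β)) = m)
    (hB : 0 ≤ B) (hBm : B * m = 3 * β ^ 2 + 1) (hβ : 0 ≤ β) (hε : 0 < ε) {p : Quadrant}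
    (hp : ε ≤ p.height) (h : IsUrnNoise P U V W) {n : ℕ} {Y : Ω → unitInterval}
    (hY : Measurable[h.history n] Y) :
    ∫ ω, lyapunov ε B (Y ω) (urn μ ν U V W p ω (n + 1)) ∂P ≤
      ∫ ω, lyapunov ε B (Y ω) (urn μ ν U V W p ω n) ∂P -
        ∫ ω, decayRate β (urn μ ν U V W p ω n) ∂P := by
  have hYm : Measurable Y := hY.mono (h.history.le n) le_rfl
  have hb : ∀ (c : unitInterval) q, |lyapunov ε B c q| ≤ 1 + B / ε := fun c q =>
    abs_lyapunov_le hε hB c.2 q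
  rw [h.integral_urn_succ μ ν p n hY (g := fun a q => lyapunov ε B a q)
    (measurable_uncurry_lyapunov hε B) hb,
    ← integral_sub (h.integrable_lyapunov hε hB hYm n) (h.integrable_decayRate hβ p n)]
  refine integral_mono_of_nonneg (Eventually.of_forall fun ω => ?_)
    ((h.integrable_lyapunov hε hB hYm n).sub (h.integrable_decayRate hβ p n))
    (Eventually.of_forall fun ω => stepAt_lyapunov_le hμ hν hB hBm hε (Y ω).2
      (hp.trans (height_le_height_urn μ ν U V W p ω n)))
  have h0 : ∀ a q, 0 ≤ lyapunov ε B a q := lyapunov_nonneg hε hB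
  exact add_nonneg (mul_nonneg (unitInterval.nonneg _) (integral_nonneg fun k => h0 _ _))
    (mul_nonneg (unitInterval.one_minus_nonneg _) (integral_nonneg fun k => h0 _ _))

/-- The expected drops of a nonnegative function telescope, so they are summable and tend to zero.
-/
theorem tendsto_integral_decayRate {m B : ℝ}
    (hμ : ∫ k, (k : ℝ) ∂(μ : Measure (Set.Icc (0 : ℝ) β)) = m)
    (hν : ∫ k, (k : ℝ) ∂(ν : Measure (Set.Icc (0 : ℝ) β)) = m)
    (hB : 0 ≤ B) (hBm : B * m = 3 * β ^ 2 + 1) (hβ : 0 ≤ β) (p : Quadrant)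
    (h : IsUrnNoise P U V W) :
    Tendsto (fun n => ∫ ω, decayRate β (urn μ ν U V W p ω n) ∂P) atTop (𝓝 0) := by
  set v : ℕ → ℝ := fun n => ∫ ω, lyapunov p.height B (0 : unitInterval) (urn μ ν U V W p ω n) ∂P
  have hv : ∀ n, 0 ≤ v n := fun n => integral_nonneg fun ω => lyapunov_nonneg p.height_pos hB _ _
  have hsum : ∀ N, ∑ n ∈ Finset.range N, ∫ ω, decayRate β (urn μ ν U V W p ω n) ∂P ≤ v 0 := by
    intro N
    have : ∑ n ∈ Finset.range N, ∫ ω, decayRate β (urn μ ν U V W p ω n) ∂P ≤ v 0 - v N := by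
      rw [← Finset.sum_range_sub']
      refine Finset.sum_le_sum fun n _ => ?_
      have := h.integral_lyapunov_succ_le hμ hν hB hBm hβ p.height_pos le_rfl (n := n)
        (Y := fun _ => 0) measurable_const
      simp only [v]
      linarith
    linarith [hv N]
  exact (summable_of_sum_range_le
    (fun n => integral_nonneg fun ω => (decayRate_pos hβ _).le) hsum).tendsto_atTop_zero

/-- The total mass of the urn tends to infinity. -/
theorem ae_tendsto_height {m B : ℝ}
    (hμ : ∫ k, (k : ℝ) ∂(μ : Measure (Set.Icc (0 : ℝ) β)) = m)
    (hν : ∫ k, (k : ℝ) ∂(ν : Measure (Set.Icc (0 : ℝ) β)) = m)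
    (hB : 0 ≤ B) (hBm : B * m = 3 * β ^ 2 + 1) (hβ : 0 ≤ β) (p : Quadrant)
    (h : IsUrnNoise P U V W) :
    ∀ᵐ ω ∂P, Tendsto (fun n => (urn μ ν U V W p ω n).height) atTop atTop := by
  -- The rates decrease along each path, and their limit has integral zero, hence vanishes almost
  -- surely. A path with bounded mass, converging to $l$, would instead have limit rate
  -- $1/(l(l+\beta))>0$.
  set d : ℕ → Ω → ℝ := fun n ω => decayRate β (urn μ ν U V W p ω n)
  have hd0 : ∀ n ω, 0 ≤ d n ω := fun n ω => (decayRate_pos hβ _).le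
  have hlim : ∀ ω, Tendsto (fun n => d n ω) atTop (𝓝 (⨅ n, d n ω)) := fun ω =>
    tendsto_atTop_ciInf (fun i j hij => decayRate_anti hβ (monotone_height_urn μ ν U V W p ω hij))
      ⟨0, by rintro _ ⟨n, rfl⟩; exact hd0 n ω⟩
  have hle : ∀ n ω, ‖d n ω‖ ≤ decayRate β p := fun n ω => by
    rw [Real.norm_eq_abs, abs_of_nonneg (hd0 n ω)]
    exact decayRate_anti hβ (height_le_height_urn μ ν U V W p ω n)
  have hI := tendsto_integral_of_dominated_convergence (μ := P) (fun _ => decayRate β p)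
    (fun n => (h.integrable_decayRate hβ p n).aestronglyMeasurable) (integrable_const _)
    (fun n => Eventually.of_forall (hle n)) (Eventually.of_forall hlim)
  have h0 := tendsto_nhds_unique hI (h.tendsto_integral_decayRate hμ hν hB hBm hβ p)
  have hmeas : AEStronglyMeasurable (fun ω => ⨅ n, d n ω) P :=
    aestronglyMeasurable_of_tendsto_ae atTop
      (fun n => (h.integrable_decayRate hβ p n).aestronglyMeasurable) (Eventually.of_forall hlim)
  have hint : Integrable (fun ω => ⨅ n, d n ω) P := by
    refine Integrable.of_bound hmeas (decayRate β p) (Eventually.of_forall fun ω => ?_)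
    exact le_of_tendsto (hlim ω).norm (Eventually.of_forall fun n => hle n ω)
  have hae := (integral_eq_zero_iff_of_nonneg
    (fun ω => Real.iInf_nonneg fun n => hd0 n ω) hint).1 h0
  filter_upwards [hae] with ω hω
  have hz : Tendsto (fun n => d n ω) atTop (𝓝 0) := by
    have := hlim ω
    rwa [hω] at this
  rcases tendsto_atTop_of_monotone (monotone_height_urn μ ν U V W p ω) with ht | ⟨l, hl⟩
  · exact ht
  · exfalso
    have hpl : p.height ≤ l :=
      ge_of_tendsto hl (Eventually.of_forall (height_le_height_urn μ ν U V W p ω))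
    have hl0 : 0 < l := p.height_pos.trans_le hpl
    have hne : l * (l + β) ≠ 0 := by positivity
    have h1 : Tendsto (fun n => d n ω) atTop (𝓝 (1 / (l * (l + β)))) :=
      Tendsto.div tendsto_const_nhds (hl.mul (hl.add_const β)) hne
    have h2 := tendsto_nhds_unique hz h1
    have h3 : 0 < 1 / (l * (l + β)) := by positivity
    exact h3.ne h2

/-- The Lyapunov function along the urn is a supermartingale. -/
theorem supermartingale_lyapunov {m B : ℝ}
    (hμ : ∫ k, (k : ℝ) ∂(μ : Measure (Set.Icc (0 : ℝ) β)) = m)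
    (hν : ∫ k, (k : ℝ) ∂(ν : Measure (Set.Icc (0 : ℝ) β)) = m)
    (hB : 0 ≤ B) (hBm : B * m = 3 * β ^ 2 + 1) (hβ : 0 ≤ β) (p : Quadrant)
    (h : IsUrnNoise P U V W) :
    Supermartingale (fun n ω => lyapunov p.height B (0 : unitInterval) (urn μ ν U V W p ω n))
      h.history P := by
  have hint := fun n => h.integrable_lyapunov (μ := μ) (ν := ν) (p := p) (Y := fun _ => 0)
    p.height_pos hB measurable_const n
  have hg : Continuous (lyapunov p.height B (0 : unitInterval)) :=
    (continuous_uncurry_lyapunov p.height_pos B).comp (Continuous.prodMk_right _)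
  refine supermartingale_of_setIntegral_succ_le (fun n => ?_) hint fun n A hA => ?_
  · exact (hg.measurable.comp (h.measurable_urn_history μ ν p n)).stronglyMeasurable
  · have hAm : MeasurableSet A := h.history.le n _ hA
    -- The indicator of a past event, read as a $[0,1]$-valued variable, turns the integral over `A`
    -- into an instance of the Markov property.
    have hY : Measurable[h.history n] (A.indicator fun _ => (1 : unitInterval)) :=
      Measurable.indicator (mβ := inferInstance) measurable_const hA
    have hind : ∀ (f : Ω → ℝ), ∫ ω in A, f ω ∂P =
        ∫ ω, ((A.indicator (fun _ => (1 : unitInterval)) ω : unitInterval) : ℝ) * f ω ∂P := fun f => by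
      rw [← integral_indicator hAm]
      refine integral_congr_ae (Eventually.of_forall fun ω => ?_)
      by_cases hω : ω ∈ A <;> simp [hω]
    have hYm : Measurable (A.indicator fun _ => (1 : unitInterval)) :=
      hY.mono (h.history.le n) le_rfl
    rw [hind, hind, h.integral_urn_succ μ ν p n hY
      (g := fun c q => (c : ℝ) * lyapunov p.height B (0 : unitInterval) q) (C := 1 + B / p.height)
      ((measurable_subtype_coe.comp measurable_fst).mul (hg.measurable.comp measurable_snd))
      fun c q => by
        rw [abs_mul, abs_of_nonneg c.2.1]
        exact (mul_le_of_le_one_left (abs_nonneg _) c.2.2).trans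
          (abs_lyapunov_le p.height_pos hB (0 : unitInterval).2 q)]
    refine integral_mono_of_nonneg (Eventually.of_forall fun ω => ?_) ?_
      (Eventually.of_forall fun ω => ?_)
    · have h0 : ∀ a q, 0 ≤ lyapunov p.height B a q := lyapunov_nonneg p.height_pos hB
      exact add_nonneg (mul_nonneg (unitInterval.nonneg _)
          (integral_nonneg fun k => mul_nonneg (unitInterval.nonneg _) (h0 _ _)))
        (mul_nonneg (unitInterval.one_minus_nonneg _)
          (integral_nonneg fun k => mul_nonneg (unitInterval.nonneg _) (h0 _ _)))
    · exact (hint n).bdd_mul (c := 1) (measurable_subtype_coe.comp hYm).aestronglyMeasurable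
        (Eventually.of_forall fun ω => by
          rw [Real.norm_eq_abs, abs_of_nonneg (unitInterval.nonneg _)]
          exact unitInterval.le_one _)
    · change stepAt μ ν (fun q => _ * lyapunov p.height B (0 : unitInterval) q) _ ≤ _
      rw [stepAt_const_mul]
      refine mul_le_mul_of_nonneg_left ?_ (unitInterval.nonneg _)
      refine (stepAt_lyapunov_le hμ hν hB hBm p.height_pos (0 : unitInterval).2
        (height_le_height_urn μ ν U V W p ω n)).trans (sub_le_self _ ?_)
      exact (decayRate_pos hβ _).le

/-- The proportion of black balls converges almost surely. -/
theorem ae_exists_tendsto_ratio {m B : ℝ}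
    (hμ : ∫ k, (k : ℝ) ∂(μ : Measure (Set.Icc (0 : ℝ) β)) = m)
    (hν : ∫ k, (k : ℝ) ∂(ν : Measure (Set.Icc (0 : ℝ) β)) = m)
    (hB : 0 ≤ B) (hBm : B * m = 3 * β ^ 2 + 1) (hβ : 0 ≤ β) (p : Quadrant)
    (h : IsUrnNoise P U V W) :
    ∀ᵐ ω ∂P, ∃ z, Tendsto (fun n => (urn μ ν U V W p ω n).ratio) atTop (𝓝 z) := by
  have hsub := (h.supermartingale_lyapunov hμ hν hB hBm hβ p).neg
  have hbd : ∀ n, eLpNorm ((-fun n ω =>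
      lyapunov p.height B (0 : unitInterval) (urn μ ν U V W p ω n)) n) 1 P ≤
      (1 + B / p.height).toNNReal := fun n => by
    refine (eLpNorm_le_of_ae_bound (C := 1 + B / p.height)
      (Eventually.of_forall fun ω => ?_)).trans ?_
    · rw [Pi.neg_apply, Pi.neg_apply, norm_neg]
      exact abs_lyapunov_le p.height_pos hB (0 : unitInterval).2 _
    · simp [ENNReal.ofReal]
  filter_upwards [hsub.exists_ae_tendsto_of_bdd hbd, h.ae_tendsto_height hμ hν hB hBm hβ p]
    with ω hω hh
  obtain ⟨c, hc⟩ := hω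
  -- The mass tends to infinity, so $B/s_n$ vanishes and $R_n^2$ alone converges. The centre is 0
  -- and $R_n\ge0$, so a square root recovers $R_n$.
  have h1 : Tendsto (fun n => B / max p.height (urn μ ν U V W p ω n).height) atTop (𝓝 0) :=
    (tendsto_atTop_mono (fun n => le_max_right _ _) hh).const_div_atTop B
  have h2 : Tendsto (fun n => ((urn μ ν U V W p ω n).ratio : ℝ) ^ 2) atTop (𝓝 (-c - 0)) := by
    refine (hc.neg.sub h1).congr fun n => ?_
    simp [lyapunov]
  have h3 := h2.sqrt
  simp only [Real.sqrt_sq (unitInterval.nonneg _)] at h3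
  have hz : √(-c - 0) ∈ Set.Icc (0 : ℝ) 1 :=
    isClosed_Icc.mem_of_tendsto h3 (Eventually.of_forall fun n => (urn μ ν U V W p ω n).ratio.2)
  exact ⟨⟨_, hz⟩, tendsto_subtype_rng.2 h3⟩

/-! ### The limit proportion and its rate of approximation -/

theorem exists_limit {m B : ℝ}
    (hμ : ∫ k, (k : ℝ) ∂(μ : Measure (Set.Icc (0 : ℝ) β)) = m)
    (hν : ∫ k, (k : ℝ) ∂(ν : Measure (Set.Icc (0 : ℝ) β)) = m)
    (hB : 0 ≤ B) (hBm : B * m = 3 * β ^ 2 + 1) (hβ : 0 ≤ β) (p : Quadrant)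
    (h : IsUrnNoise P U V W) :
    ∃ Z : Ω → unitInterval, Measurable Z ∧
      ∀ᵐ ω ∂P, Tendsto (fun n => (urn μ ν U V W p ω n).ratio) atTop (𝓝 (Z ω)) :=
  measurable_limit_of_tendsto_metrizable_ae
    (fun n => (h.measurable_ratio_urn p n).aemeasurable)
    (h.ae_exists_tendsto_ratio hμ hν hB hBm hβ p)

/-- The mean square distance of the limit proportion from the proportion after `N` draws. -/
theorem integral_sq_sub_le {m B ε : ℝ}
    (hμ : ∫ k, (k : ℝ) ∂(μ : Measure (Set.Icc (0 : ℝ) β)) = m)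
    (hν : ∫ k, (k : ℝ) ∂(ν : Measure (Set.Icc (0 : ℝ) β)) = m)
    (hB : 0 ≤ B) (hBm : B * m = 3 * β ^ 2 + 1) (hβ : 0 ≤ β) (hε : 0 < ε) {p : Quadrant}
    (hp : ε ≤ p.height) (h : IsUrnNoise P U V W) {Z : Ω → unitInterval}
    (hlim : ∀ᵐ ω ∂P, Tendsto (fun n => (urn μ ν U V W p ω n).ratio) atTop (𝓝 (Z ω))) (N : ℕ) :
    ∫ ω, ((Z ω : ℝ) - (urn μ ν U V W p ω N).ratio) ^ 2 ∂P ≤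
      B * (stepOp μ ν)^[N] (invHeight hε) p := by
  set R : ℕ → Ω → unitInterval := fun n ω => (urn μ ν U V W p ω n).ratio
  have hR : ∀ n, Measurable (R n) := h.measurable_ratio_urn p
  have hRN : Measurable[h.history N] (R N) :=
    continuous_ratio.measurable.comp (h.measurable_urn_history μ ν p N)
  -- With the centre frozen at $R_N$ the square vanishes at time $N$ and only $B/s_N$ remains. The
  -- later expectations do not exceed this value, since $R_N$ stays measurable for every later
  -- history.
  have hstart : ∫ ω, lyapunov ε B (R N ω) (urn μ ν U V W p ω N) ∂P =
      B * (stepOp μ ν)^[N] (invHeight hε) p := by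
    rw [← h.integral_urn, ← integral_const_mul]
    refine integral_congr_ae (Eventually.of_forall fun ω => ?_)
    simp [lyapunov_eq, invHeight_apply, R]
  have hdec : ∀ j, ∫ ω, lyapunov ε B (R N ω) (urn μ ν U V W p ω (N + j)) ∂P ≤
      B * (stepOp μ ν)^[N] (invHeight hε) p := by
    intro j
    induction j with
    | zero => exact hstart.le
    | succ j ih =>
      have h1 := h.integral_lyapunov_succ_le hμ hν hB hBm hβ hε hp (n := N + j) (Y := R N)
        (hRN.mono (h.history.mono (Nat.le_add_right N j)) le_rfl)
      have h2 : 0 ≤ ∫ ω, decayRate β (urn μ ν U V W p ω (N + j)) ∂P :=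
        integral_nonneg fun ω => (decayRate_pos hβ _).le
      rw [← Nat.add_assoc]
      linarith
  have hbd : ∀ a b : unitInterval, ‖((a : ℝ) - b) ^ 2‖ ≤ 1 := fun a b => by
    rw [Real.norm_eq_abs, abs_of_nonneg (sq_nonneg _), sq_le_one_iff_abs_le_one]
    exact abs_le.2 ⟨by linarith [a.2.1, b.2.2], by linarith [a.2.2, b.2.1]⟩
  have hmeas : ∀ n, Measurable fun ω => ((R n ω : ℝ) - R N ω) ^ 2 := fun n =>
    ((measurable_subtype_coe.comp (hR n)).sub (measurable_subtype_coe.comp (hR N))).pow_const 2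
  have hle : ∀ j, ∫ ω, ((R (j + N) ω : ℝ) - R N ω) ^ 2 ∂P ≤
      B * (stepOp μ ν)^[N] (invHeight hε) p := fun j => by
    rw [Nat.add_comm]
    refine le_trans (integral_mono (Integrable.of_bound (hmeas _).aestronglyMeasurable 1
      (Eventually.of_forall fun ω => hbd _ _)) (h.integrable_lyapunov hε hB (hR N) _)
      fun ω => ?_) (hdec j)
    exact le_add_of_nonneg_right (div_nonneg hB (lt_max_of_lt_left hε).le)
  have hT := tendsto_integral_of_dominated_convergence (μ := P) (fun _ => (1 : ℝ))
    (F := fun j ω => ((R (j + N) ω : ℝ) - R N ω) ^ 2) (f := fun ω => ((Z ω : ℝ) - R N ω) ^ 2)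
    (fun j => (hmeas _).aestronglyMeasurable) (integrable_const _)
    (fun j => Eventually.of_forall fun ω => hbd _ _) (by
      filter_upwards [hlim] with ω hω
      exact ((((continuous_subtype_val.tendsto _).comp hω).comp
        (tendsto_add_atTop_nat N)).sub_const _).pow 2)
  exact le_of_tendsto hT (Eventually.of_forall hle)

/-- Passes from mean square to mean distance by $c\le c^2/(2\delta)+\delta/2$. -/
theorem integral_dist_le {m B ε δ : ℝ}
    (hμ : ∫ k, (k : ℝ) ∂(μ : Measure (Set.Icc (0 : ℝ) β)) = m)
    (hν : ∫ k, (k : ℝ) ∂(ν : Measure (Set.Icc (0 : ℝ) β)) = m)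
    (hB : 0 ≤ B) (hBm : B * m = 3 * β ^ 2 + 1) (hβ : 0 ≤ β) (hε : 0 < ε) {p : Quadrant}
    (hp : ε ≤ p.height) (h : IsUrnNoise P U V W) {Z : Ω → unitInterval} (hZ : Measurable Z)
    (hlim : ∀ᵐ ω ∂P, Tendsto (fun n => (urn μ ν U V W p ω n).ratio) atTop (𝓝 (Z ω))) {N : ℕ}
    (hδ : 0 < δ) (hN : B * (stepOp μ ν)^[N] (invHeight hε) p ≤ δ ^ 2) :
    ∫ ω, dist (Z ω) (urn μ ν U V W p ω N).ratio ∂P ≤ δ := by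
  have hsq := (h.integral_sq_sub_le hμ hν hB hBm hβ hε hp hlim N).trans hN
  have hR := h.measurable_ratio_urn (μ := μ) (ν := ν) p N
  have hint : Integrable (fun ω => ((Z ω : ℝ) - (urn μ ν U V W p ω N).ratio) ^ 2) P := by
    refine Integrable.of_bound (((measurable_subtype_coe.comp hZ).sub
      (measurable_subtype_coe.comp hR)).pow_const 2).aestronglyMeasurable 1
      (Eventually.of_forall fun ω => ?_)
    rw [Real.norm_eq_abs, abs_of_nonneg (sq_nonneg _), sq_le_one_iff_abs_le_one]
    set a := Z ω
    set b := (urn μ ν U V W p ω N).ratio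
    exact abs_le.2 ⟨by linarith [a.2.1, b.2.2], by linarith [a.2.2, b.2.1]⟩
  calc ∫ ω, dist (Z ω) (urn μ ν U V W p ω N).ratio ∂P
      ≤ ∫ ω, ((2 * δ)⁻¹ * ((Z ω : ℝ) - (urn μ ν U V W p ω N).ratio) ^ 2 + δ / 2) ∂P := by
        refine integral_mono_of_nonneg (Eventually.of_forall fun ω => dist_nonneg)
          ((hint.const_mul _).add (integrable_const _)) (Eventually.of_forall fun ω => ?_)
        change dist (Z ω) (urn μ ν U V W p ω N).ratio ≤ (2 * δ)⁻¹ * _ + _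
        rw [Subtype.dist_eq, Real.dist_eq, ← sq_abs]
        set c := |(Z ω : ℝ) - (urn μ ν U V W p ω N).ratio|
        have e : (2 * δ)⁻¹ * c ^ 2 + δ / 2 - c = (2 * δ)⁻¹ * (c - δ) ^ 2 := by
          field_simp
          ring
        have : 0 ≤ (2 * δ)⁻¹ * (c - δ) ^ 2 := by positivity
        linarith
    _ = (2 * δ)⁻¹ * ∫ ω, ((Z ω : ℝ) - (urn μ ν U V W p ω N).ratio) ^ 2 ∂P + δ / 2 := by
        rw [integral_add (hint.const_mul _) (integrable_const _), integral_const_mul]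
        simp
    _ ≤ (2 * δ)⁻¹ * δ ^ 2 + δ / 2 := by gcongr
    _ = δ := by
        field_simp
        ring

/-- The iterates are the expectations of $1/\max(\varepsilon,s_n)$, which vanish by dominated
convergence because $s_n\to\infty$. -/
theorem tendsto_iterate_invHeight {m B ε : ℝ}
    (hμ : ∫ k, (k : ℝ) ∂(μ : Measure (Set.Icc (0 : ℝ) β)) = m)
    (hν : ∫ k, (k : ℝ) ∂(ν : Measure (Set.Icc (0 : ℝ) β)) = m)
    (hB : 0 ≤ B) (hBm : B * m = 3 * β ^ 2 + 1) (hβ : 0 ≤ β) (hε : 0 < ε) (p : Quadrant)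
    (h : IsUrnNoise P U V W) :
    Tendsto (fun n => (stepOp μ ν)^[n] (invHeight hε) p) atTop (𝓝 0) := by
  have hT := tendsto_integral_of_dominated_convergence (μ := P) (fun _ => ‖invHeight hε‖)
    (F := fun n ω => invHeight hε (urn μ ν U V W p ω n)) (f := fun _ => 0)
    (fun n => ((invHeight hε).continuous.measurable.comp
      (h.measurable_urn μ ν p n)).aestronglyMeasurable) (integrable_const _)
    (fun n => Eventually.of_forall fun ω => (invHeight hε).norm_coe_le_norm _) (by
      filter_upwards [h.ae_tendsto_height hμ hν hB hBm hβ p] with ω hω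
      exact (tendsto_atTop_mono (fun n => le_max_right _ _) hω).inv_tendsto_atTop)
  simpa [h.integral_urn] using hT

/-- Expectations of functions of the urn whose values converge to a function of the limit
proportion. -/
theorem tendsto_iterate_stepOp (p : Quadrant) (h : IsUrnNoise P U V W) {Z : Ω → unitInterval}
    (hZ : Measurable Z)
    (g : ℕ → Quadrant →ᵇ ℝ) (f : unitInterval → ℝ) (hf : Continuous f) (C : ℝ)
    (hC : ∀ n q, |g n q| ≤ C)
    (hg : ∀ᵐ ω ∂P, Tendsto (fun n => g n (urn μ ν U V W p ω n)) atTop (𝓝 (f (Z ω)))) :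
    Tendsto (fun n => (stepOp μ ν)^[n] (g n) p) atTop
      (𝓝 (∫ s, f s ∂(ProbI.law P Z hZ).toMeasure)) := by
  rw [ProbI.law_toMeasure, integral_map hZ.aemeasurable hf.aestronglyMeasurable]
  simp only [← h.integral_urn]
  exact tendsto_integral_of_dominated_convergence (fun _ => C)
    (fun n => ((g n).continuous.measurable.comp (h.measurable_urn μ ν p n)).aestronglyMeasurable)
    (integrable_const _) (fun n => Eventually.of_forall fun ω => hC n _) hg

end IsUrnNoise
end

noncomputable section

open scoped BoundedContinuousFunction
open Quadrant

/-! ### A probability space that carries the noise -/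

/-- The law of two independent sequences of independent uniform variables. -/
def noiseMeasure : Measure ((ℕ → unitInterval) × (ℕ → unitInterval)) :=
  (Measure.infinitePi fun _ => volume).prod (Measure.infinitePi fun _ => volume)

instance : IsProbabilityMeasure noiseMeasure :=
  inferInstanceAs (IsProbabilityMeasure (Measure.prod _ _))

theorem iIndepFun_of_map {Ω Ω' ι : Type*} [MeasurableSpace Ω] [MeasurableSpace Ω']
    {𝓧 : ι → Type*} [∀ i, MeasurableSpace (𝓧 i)] {P : Measure Ω} {T : Ω → Ω'}
    (hT : Measurable T) {X : ∀ i, Ω' → 𝓧 i} (hX : ∀ i, Measurable (X i))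
    (h : iIndepFun X (P.map T)) : iIndepFun (fun i => X i ∘ T) P := by
  rw [iIndepFun_iff_measure_inter_preimage_eq_mul] at h ⊢
  intro S sets hs
  have := h S hs
  rw [Measure.map_apply hT (Finset.measurableSet_biInter _ fun i hi => hX i (hs i hi))] at this
  simp only [Set.preimage_iInter] at this
  rw [Finset.prod_congr rfl fun i hi => Measure.map_apply hT (hX i (hs i hi))] at this
  exact this

/-- A concrete noise on which the limit laws are built. It takes $V=W$, which is allowed because the
joint law of the pair is arbitrary. -/
theorem isUrnNoise_noiseMeasure :
    IsUrnNoise noiseMeasure (fun n ω => ω.1 n) (fun n ω => ω.2 n) (fun n ω => ω.2 n) := by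
  have h1 : ∀ n : ℕ, Measurable fun ω : (ℕ → unitInterval) × (ℕ → unitInterval) => ω.1 n :=
    fun n => (measurable_pi_apply n).comp measurable_fst
  have h2 : ∀ n : ℕ, Measurable fun ω : (ℕ → unitInterval) × (ℕ → unitInterval) => ω.2 n :=
    fun n => (measurable_pi_apply n).comp measurable_snd
  have m1 : noiseMeasure.map Prod.fst = Measure.infinitePi fun _ => volume := by
    rw [noiseMeasure, Measure.map_fst_prod]
    simp
  have m2 : noiseMeasure.map Prod.snd = Measure.infinitePi fun _ => volume := by
    rw [noiseMeasure, Measure.map_snd_prod]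
    simp
  have l1 : ∀ n, noiseMeasure.map (fun ω => ω.1 n) = volume := fun n => by
    rw [← Measure.infinitePi_map_eval (fun _ : ℕ => (volume : Measure unitInterval)) n, ← m1,
      Measure.map_map (measurable_pi_apply n) measurable_fst]
    rfl
  have l2 : ∀ n, noiseMeasure.map (fun ω => ω.2 n) = volume := fun n => by
    rw [← Measure.infinitePi_map_eval (fun _ : ℕ => (volume : Measure unitInterval)) n, ← m2,
      Measure.map_map (measurable_pi_apply n) measurable_snd]
    rfl
  have hd : Measurable fun t : unitInterval => (t, t) := measurable_id.prodMk measurable_id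
  refine ⟨h1, h2, h2, l1, l2, l2, ?_, ?_, fun n => ⟨((h2 n).prodMk (h2 n)).aemeasurable,
    ((h2 0).prodMk (h2 0)).aemeasurable, ?_⟩, ?_⟩
  · refine iIndepFun_of_map (T := Prod.fst) (X := fun n (f : ℕ → unitInterval) => f n)
      measurable_fst (fun n => measurable_pi_apply n) ?_
    rw [m1]
    exact iIndepFun_infinitePi (X := fun _ t => t) fun n => measurable_id
  · refine iIndepFun_of_map (T := Prod.snd) (X := fun n (f : ℕ → unitInterval) => (f n, f n))
      measurable_snd (fun n => hd.comp (measurable_pi_apply n)) ?_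
    rw [m2]
    exact iIndepFun_infinitePi (X := fun _ t => (t, t)) fun n => hd
  · have e : ∀ n, noiseMeasure.map (fun ω => (ω.2 n, ω.2 n)) =
        (volume : Measure unitInterval).map fun t => (t, t) := fun n => by
      rw [← l2 n, Measure.map_map hd (h2 n)]
      rfl
    rw [e, e]
  · have hd' : Measurable fun (f : ℕ → unitInterval) n => (f n, f n) :=
      measurable_pi_lambda _ fun n => hd.comp (measurable_pi_apply n)
    exact indepFun_prod₀ measurable_id.aemeasurable hd'.aemeasurable

/-! ### The canonical solution -/

/-- A continuous function of the proportion, as a bounded function of the composition. -/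
def compRatio (f : C(unitInterval, ℝ)) : Quadrant →ᵇ ℝ :=
  (BoundedContinuousFunction.mkOfCompact f).compContinuous ⟨ratio, continuous_ratio⟩

theorem compRatio_apply (f : C(unitInterval, ℝ)) (p : Quadrant) : compRatio f p = f p.ratio := rfl

variable {β : ℝ} (μ ν : ProbabilityMeasure (Set.Icc (0 : ℝ) β))

/-- `F p` is the limit law of the proportion of black balls in the urn started from `p`. -/
def IsLimitLaw (F : Quadrant → ProbI) : Prop :=
  ∀ (p : Quadrant) (f : C(unitInterval, ℝ)),
    Tendsto (fun n => (stepOp μ ν)^[n] (compRatio f) p) atTop (𝓝 (∫ s, f s ∂(F p).toMeasure))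

variable {μ ν}

theorem IsUrnNoise.tendsto_iterate_compRatio {Ω : Type*} [MeasurableSpace Ω] {P : Measure Ω}
    [IsProbabilityMeasure P] {U V W : ℕ → Ω → unitInterval} (h : IsUrnNoise P U V W) (p : Quadrant)
    {Z : Ω → unitInterval} (hZ : Measurable Z)
    (hlim : ∀ᵐ ω ∂P, Tendsto (fun n => (urn μ ν U V W p ω n).ratio) atTop (𝓝 (Z ω)))
    (f : C(unitInterval, ℝ)) :
    Tendsto (fun n => (stepOp μ ν)^[n] (compRatio f) p) atTop
      (𝓝 (∫ s, f s ∂(ProbI.law P Z hZ).toMeasure)) := by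
  refine h.tendsto_iterate_stepOp p hZ (fun _ => compRatio f) f f.continuous ‖compRatio f‖
    (fun n q => (compRatio f).norm_coe_le_norm q) ?_
  filter_upwards [hlim] with ω hω
  exact (f.continuous.tendsto _).comp hω

/-- `IsLimitLaw` refers only to iterates of the transition operator, so every probability space and
every joint law of $(V,W)$ leads to the same limit law. -/
theorem IsLimitLaw.eq_law {F : Quadrant → ProbI} (hF : IsLimitLaw μ ν F) {Ω : Type*}
    [MeasurableSpace Ω] {P : Measure Ω} [IsProbabilityMeasure P] {U V W : ℕ → Ω → unitInterval}
    (h : IsUrnNoise P U V W) (p : Quadrant) {Z : Ω → unitInterval} (hZ : Measurable Z)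
    (hlim : ∀ᵐ ω ∂P, Tendsto (fun n => (urn μ ν U V W p ω n).ratio) atTop (𝓝 (Z ω))) :
    F p = ProbI.law P Z hZ :=
  ProbI.eq_of_forall_integral fun f =>
    tendsto_nhds_unique (hF p f) (h.tendsto_iterate_compRatio p hZ hlim f)

/-- The limit law is harmonic. -/
theorem IsLimitLaw.stepAt_integral {F : Quadrant → ProbI} (hF : IsLimitLaw μ ν F)
    (f : C(unitInterval, ℝ)) (p : Quadrant) :
    stepAt μ ν (fun q => ∫ s, f s ∂(F q).toMeasure) p = ∫ s, f s ∂(F p).toMeasure := by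
  have hb : ∀ n q, ‖(stepOp μ ν)^[n] (compRatio f) q‖ ≤ ‖compRatio f‖ := by
    intro n
    induction n with
    | zero => exact fun q => (compRatio f).norm_coe_le_norm q
    | succ n ih =>
      intro q
      rw [Function.iterate_succ_apply']
      exact abs_stepAt_le μ ν ih q
  have h1 := tendsto_integral_of_dominated_convergence
    (μ := (μ : Measure (Set.Icc (0 : ℝ) β)))
    (F := fun n k => (stepOp μ ν)^[n] (compRatio f) (p.shiftX k)) (fun _ => ‖compRatio f‖)
    (fun n => (((stepOp μ ν)^[n] (compRatio f)).continuous.comp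
      p.continuous_shiftX_right).aestronglyMeasurable) (integrable_const _)
    (fun n => Eventually.of_forall fun k => hb n _)
    (Eventually.of_forall fun k => hF (p.shiftX k) f)
  have h2 := tendsto_integral_of_dominated_convergence
    (μ := (ν : Measure (Set.Icc (0 : ℝ) β)))
    (F := fun n k => (stepOp μ ν)^[n] (compRatio f) (p.shiftY k)) (fun _ => ‖compRatio f‖)
    (fun n => (((stepOp μ ν)^[n] (compRatio f)).continuous.comp
      p.continuous_shiftY_right).aestronglyMeasurable) (integrable_const _)
    (fun n => Eventually.of_forall fun k => hb n _)
    (Eventually.of_forall fun k => hF (p.shiftY k) f)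
  -- One step applied to the $n$-th iterate is the iterate $n+1$, whose limit is again the integral
  -- against `F p`.
  have h3 : Tendsto (fun n => (stepOp μ ν)^[n + 1] (compRatio f) p) atTop
      (𝓝 (stepAt μ ν (fun q => ∫ s, f s ∂(F q).toMeasure) p)) := by
    simp only [Function.iterate_succ_apply']
    exact (h1.const_mul _).add (h2.const_mul _)
  exact tendsto_nhds_unique h3 ((tendsto_add_atTop_iff_nat 1).2 (hF p f))

theorem ratio_eq_zero {p : Quadrant} (hp : p.x = 0) : p.ratio = 0 :=
  Subtype.ext (by simp [coe_ratio, hp])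

theorem ratio_eq_one {p : Quadrant} (hp : p.y = 0) : p.ratio = 1 := by
  have h := p.height_pos
  refine Subtype.ext ?_
  rw [coe_ratio]
  simp only [height, hp, add_zero] at h ⊢
  rw [div_self h.ne']
  rfl

/-- On this axis a black ball has weight zero and a white one keeps the urn on the axis, so the
proportion stays at 0. -/
theorem iterate_stepOp_of_x_eq_zero (f : C(unitInterval, ℝ)) (n : ℕ) {p : Quadrant}
    (hp : p.x = 0) : (stepOp μ ν)^[n] (compRatio f) p = f 0 := by
  induction n generalizing p with
  | zero => rw [Function.iterate_zero_apply, compRatio_apply, ratio_eq_zero hp]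
  | succ n ih =>
    have h : ∀ k : Set.Icc (0 : ℝ) β, (stepOp μ ν)^[n] (compRatio f) (p.shiftY k) = f 0 :=
      fun k => ih hp
    rw [Function.iterate_succ_apply', stepOp_apply, stepAt, ratio_eq_zero hp]
    simp [h]

theorem iterate_stepOp_of_y_eq_zero (f : C(unitInterval, ℝ)) (n : ℕ) {p : Quadrant}
    (hp : p.y = 0) : (stepOp μ ν)^[n] (compRatio f) p = f 1 := by
  induction n generalizing p with
  | zero => rw [Function.iterate_zero_apply, compRatio_apply, ratio_eq_one hp]
  | succ n ih =>
    have h : ∀ k : Set.Icc (0 : ℝ) β, (stepOp μ ν)^[n] (compRatio f) (p.shiftX k) = f 1 :=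
      fun k => ih hp
    rw [Function.iterate_succ_apply', stepOp_apply, stepAt, ratio_eq_one hp]
    simp [h]

theorem integral_pointMass (f : C(unitInterval, ℝ)) (t : unitInterval) :
    ∫ s, f s ∂(pointMass t).toMeasure = f t := integral_dirac _ _

theorem IsLimitLaw.y_axis {F : Quadrant → ProbI} (hF : IsLimitLaw μ ν F) {p : Quadrant}
    (hp : p.x = 0) : F p = pointMass 0 :=
  ProbI.eq_of_forall_integral fun f => by
    rw [integral_pointMass]
    refine tendsto_nhds_unique (hF p f) ?_
    simp only [iterate_stepOp_of_x_eq_zero f _ hp, tendsto_const_nhds]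

theorem IsLimitLaw.x_axis {F : Quadrant → ProbI} (hF : IsLimitLaw μ ν F) {p : Quadrant}
    (hp : p.y = 0) : F p = pointMass 1 :=
  ProbI.eq_of_forall_integral fun f => by
    rw [integral_pointMass]
    refine tendsto_nhds_unique (hF p f) ?_
    simp only [iterate_stepOp_of_y_eq_zero f _ hp, tendsto_const_nhds]

section

variable {m B : ℝ} (hμ : ∫ k, (k : ℝ) ∂(μ : Measure (Set.Icc (0 : ℝ) β)) = m)
  (hν : ∫ k, (k : ℝ) ∂(ν : Measure (Set.Icc (0 : ℝ) β)) = m)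
  (hB : 0 ≤ B) (hBm : B * m = 3 * β ^ 2 + 1) (hβ : 0 ≤ β)

include hμ hν hB hBm hβ

theorem exists_isLimitLaw : ∃ F : Quadrant → ProbI, IsLimitLaw μ ν F := by
  choose Z hZ hlim using fun p => isUrnNoise_noiseMeasure.exists_limit hμ hν hB hBm hβ p
  exact ⟨fun p => ProbI.law noiseMeasure (Z p) (hZ p), fun p f =>
    isUrnNoise_noiseMeasure.tendsto_iterate_compRatio p (hZ p) (hlim p) f⟩

/-- Approximation of the limit law by the law after finitely many draws. -/
theorem IsLimitLaw.exists_approx {F : Quadrant → ProbI} (hF : IsLimitLaw μ ν F) (N : ℕ) :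
    ∃ L : Quadrant → ProbI,
      (∀ p (f : C(unitInterval, ℝ)),
        ∫ s, f s ∂(L p).toMeasure = (stepOp μ ν)^[N] (compRatio f) p) ∧
      ∀ (p : Quadrant) (ε δ : ℝ) (hε : 0 < ε), ε ≤ p.height → 0 < δ →
        B * (stepOp μ ν)^[N] (invHeight hε) p ≤ δ ^ 2 → dist (F p) (L p) ≤ δ := by
  have hn := isUrnNoise_noiseMeasure
  refine ⟨fun p => ProbI.law noiseMeasure _ (hn.measurable_ratio_urn (μ := μ) (ν := ν) p N),
    fun p f => ?_, fun p ε δ hε hp hδ hN => ?_⟩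
  · rw [ProbI.law_toMeasure, integral_map (hn.measurable_ratio_urn p N).aemeasurable
      f.continuous.aestronglyMeasurable, ← hn.integral_urn]
    rfl
  -- The limit proportion and the proportion after $N$ draws live on one space, so they couple the
  -- two laws.
  · obtain ⟨Z, hZ, hlim⟩ := hn.exists_limit hμ hν hB hBm hβ p
    rw [hF.eq_law hn p hZ hlim]
    exact (ProbI.dist_law_le _ _ _).trans
      (hn.integral_dist_le hμ hν hB hBm hβ hε hp hZ hlim hδ hN)

/-- A locally uniform limit of continuous maps: the error bound after $N$ draws is itself continuous
in the starting point, so once small at `p` it is small nearby. -/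
theorem IsLimitLaw.continuous {F : Quadrant → ProbI} (hF : IsLimitLaw μ ν F) : Continuous F := by
  refine continuous_of_locally_uniform_approx_of_continuousAt fun p u hu => ?_
  obtain ⟨δ, hδ, hu⟩ := Metric.mem_uniformity_dist.1 hu
  -- Half the height leaves room for a neighbourhood of `p` on which the truncation is inactive.
  have hε : 0 < p.height / 2 := half_pos p.height_pos
  have hδ2 : 0 < (δ / 2) ^ 2 := by positivity
  have hT := (isUrnNoise_noiseMeasure.tendsto_iterate_invHeight hμ hν hB hBm hβ hε p).const_mul B
  rw [mul_zero] at hT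
  obtain ⟨N, hN⟩ := (hT.eventually_lt_const hδ2).exists
  obtain ⟨L, hL, hd⟩ := hF.exists_approx hμ hν hB hBm hβ N
  have h1 : ∀ᶠ q in 𝓝 p, B * (stepOp μ ν)^[N] (invHeight hε) q < (δ / 2) ^ 2 :=
    (continuous_const.mul ((stepOp μ ν)^[N] (invHeight hε)).continuous).tendsto p
      |>.eventually_lt_const hN
  have h2 : ∀ᶠ q in 𝓝 p, p.height / 2 < q.height :=
    (continuous_height.tendsto p).eventually_const_lt (half_lt_self p.height_pos)
  refine ⟨_, h1.and h2, L, Continuous.continuousAt ?_, fun q hq => hu ?_⟩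
  · refine ProbI.continuous_of_forall_integral fun f => ?_
    simp only [hL]
    exact ((stepOp μ ν)^[N] (compRatio f)).continuous
  · exact (hd q _ _ hε hq.2.le (half_pos hδ) hq.1.le).trans_lt (half_lt_self hδ)

/-- The approximation with no draws at all: the approximant is the point mass at the initial
proportion, and the mean square error is at most $B/s$. -/
theorem IsLimitLaw.at_infinity {F : Quadrant → ProbI} (hF : IsLimitLaw μ ν F) :
    Tendsto (fun p : Quadrant => dist (F p) (pointMass p.ratio))
      (comap (fun p : Quadrant => p.x + p.y) atTop) (𝓝 0) := by
  obtain ⟨L, hL, hd⟩ := hF.exists_approx hμ hν hB hBm hβ 0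
  have hLp : ∀ p, L p = pointMass p.ratio := fun p =>
    ProbI.eq_of_forall_integral fun f => by
      rw [hL, integral_pointMass]
      rfl
  refine Metric.tendsto_nhds.2 fun δ hδ => ?_
  have hev := (eventually_ge_atTop (B / (δ / 2) ^ 2)).comap (fun p : Quadrant => p.x + p.y)
  filter_upwards [hev] with p hp
  rw [Real.dist_0_eq_abs, abs_of_nonneg dist_nonneg, ← hLp]
  refine (hd p _ (δ / 2) p.height_pos le_rfl (half_pos hδ) ?_).trans_lt (half_lt_self hδ)
  rw [Function.iterate_zero_apply, invHeight_apply, max_self, ← div_eq_mul_inv,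
    div_le_iff₀ p.height_pos]
  rw [div_le_iff₀ (by positivity)] at hp
  rwa [mul_comm]

end
end

noncomputable section

open scoped BoundedContinuousFunction
open Quadrant

/-! ### The functional equation and harmonicity -/

variable {β : ℝ} {μ ν : ProbabilityMeasure (Set.Icc (0 : ℝ) β)}

/-- The law of `G` after one draw from `p`. -/
def stepMeasure (μ ν : ProbabilityMeasure (Set.Icc (0 : ℝ) β)) (G : C(Quadrant, ProbI))
    (p : Quadrant) : Measure unitInterval :=
  ENNReal.ofReal p.ratio • (ProbI.mix (μ : Measure (Set.Icc (0 : ℝ) β)) (fun k => G (p.shiftX k))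
    (ProbI.measurable_toMeasure (G.continuous.comp p.continuous_shiftX_right))).toMeasure +
  ENNReal.ofReal (1 - p.ratio) •
    (ProbI.mix (ν : Measure (Set.Icc (0 : ℝ) β)) (fun k => G (p.shiftY k))
    (ProbI.measurable_toMeasure (G.continuous.comp p.continuous_shiftY_right))).toMeasure

instance (G : C(Quadrant, ProbI)) (p : Quadrant) : IsFiniteMeasure (stepMeasure μ ν G p) := by
  rw [stepMeasure]
  have h1 := (ProbI.mix (μ : Measure (Set.Icc (0 : ℝ) β)) (fun k => G (p.shiftX k))
    (ProbI.measurable_toMeasure (G.continuous.comp p.continuous_shiftX_right))).toMeasure.smul_finite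
    (ENNReal.ofReal_ne_top (r := p.ratio))
  have h2 := (ProbI.mix (ν : Measure (Set.Icc (0 : ℝ) β)) (fun k => G (p.shiftY k))
    (ProbI.measurable_toMeasure (G.continuous.comp p.continuous_shiftY_right))).toMeasure.smul_finite
    (ENNReal.ofReal_ne_top (r := 1 - p.ratio))
  infer_instance

theorem integral_stepMeasure (G : C(Quadrant, ProbI)) (p : Quadrant) (f : C(unitInterval, ℝ)) :
    ∫ s, f s ∂(stepMeasure μ ν G p) = stepAt μ ν (fun q => ∫ s, f s ∂(G q).toMeasure) p := by
  rw [stepMeasure, integral_add_measure, integral_smul_measure, integral_smul_measure,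
    ProbI.integral_mix, ProbI.integral_mix, ENNReal.toReal_ofReal p.ratio.2.1,
    ENNReal.toReal_ofReal (unitInterval.one_minus_nonneg _)]
  · rfl
  · exact (integrable_of_continuous_compact _ f.continuous).smul_measure ENNReal.ofReal_ne_top
  · exact (integrable_of_continuous_compact _ f.continuous).smul_measure ENNReal.ofReal_ne_top

theorem ProbI.real_mix {α : Type*} [MeasurableSpace α] (ρ : Measure α) [IsProbabilityMeasure ρ]
    {ξ : α → ProbI} (h : Measurable fun a => (ξ a).toMeasure) {A : Set unitInterval}
    (hA : MeasurableSet A) :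
    (mix ρ ξ h).toMeasure.real A = ∫ a, (ξ a).toMeasure.real A ∂ρ := by
  have hm : Measurable fun a => (ξ a).toMeasure A := (Measure.measurable_coe hA).comp h
  rw [mix, toMeasure_mk, measureReal_def, Measure.bind_apply hA h.aemeasurable]
  exact (integral_toReal hm.aemeasurable (Eventually.of_forall fun a => measure_lt_top _ _)).symm

theorem real_stepMeasure (G : C(Quadrant, ProbI)) (p : Quadrant) {A : Set unitInterval}
    (hA : MeasurableSet A) :
    (stepMeasure μ ν G p).real A = stepAt μ ν (fun q => (G q).toMeasure.real A) p := by
  rw [stepMeasure, measureReal_add_apply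
    (h₁ := ENNReal.mul_ne_top ENNReal.ofReal_ne_top (measure_ne_top _ _))
    (h₂ := ENNReal.mul_ne_top ENNReal.ofReal_ne_top (measure_ne_top _ _)),
    measureReal_ennreal_smul_apply, measureReal_ennreal_smul_apply, ProbI.real_mix _ _ hA, ProbI.real_mix _ _ hA,
    ENNReal.toReal_ofReal p.ratio.2.1, ENNReal.toReal_ofReal (unitInterval.one_minus_nonneg _)]
  rfl

theorem integrable_real_toMeasure {X : Type*} [TopologicalSpace X] [MeasurableSpace X]
    [OpensMeasurableSpace X] (ρ : Measure X) [IsFiniteMeasure ρ] {ξ : X → ProbI}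
    (hξ : Continuous ξ) {A : Set unitInterval} (hA : MeasurableSet A) :
    Integrable (fun a => (ξ a).toMeasure.real A) ρ := by
  refine Integrable.of_bound (((Measure.measurable_coe hA).comp
    (ProbI.measurable_toMeasure hξ)).ennreal_toReal.aestronglyMeasurable) 1
    (Eventually.of_forall fun a => ?_)
  change |(ξ a).toMeasure.real A| ≤ 1
  rw [abs_of_nonneg measureReal_nonneg]
  exact measureReal_le_one

/-- The functional equation on a Borel set, in terms of the transition operator. -/
theorem equation_iff (G : C(Quadrant, ProbI)) (p : Quadrant) {A : Set unitInterval}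
    (hA : MeasurableSet A) :
    p.x * (∫ k, ((G p).toMeasure.real A - (G (p.shiftX k)).toMeasure.real A)
        ∂(μ : Measure (Set.Icc (0 : ℝ) β))) +
      p.y * (∫ k, ((G p).toMeasure.real A - (G (p.shiftY k)).toMeasure.real A)
        ∂(ν : Measure (Set.Icc (0 : ℝ) β))) = 0 ↔
      (G p).toMeasure.real A = (stepMeasure μ ν G p).real A := by
  have hX : Integrable (fun k => (G (p.shiftX k)).toMeasure.real A)
      (μ : Measure (Set.Icc (0 : ℝ) β)) :=
    integrable_real_toMeasure _ (G.continuous.comp p.continuous_shiftX_right) hA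
  have hY : Integrable (fun k => (G (p.shiftY k)).toMeasure.real A)
      (ν : Measure (Set.Icc (0 : ℝ) β)) :=
    integrable_real_toMeasure _ (G.continuous.comp p.continuous_shiftY_right) hA
  rw [real_stepMeasure G p hA, stepAt, integral_sub (integrable_const _) hX,
    integral_sub (integrable_const _) hY, coe_ratio]
  simp only [integral_const, probReal_univ, smul_eq_mul, one_mul]
  have h := p.height_pos
  have hy : 1 - p.x / p.height = p.y / p.height := by
    field_simp
    simp only [height]
    ring
  rw [hy]
  generalize (∫ k, (G (p.shiftX k)).toMeasure.real A ∂(μ : Measure (Set.Icc (0 : ℝ) β))) = a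
  generalize (∫ k, (G (p.shiftY k)).toMeasure.real A ∂(ν : Measure (Set.Icc (0 : ℝ) β))) = b
  field_simp
  simp only [height]
  constructor <;> intro h <;> linarith

/-- Both versions say that `G p` equals its average after one draw. Finite measures on $[0,1]$ are
determined by their values on Borel sets and equally by their integrals of continuous functions. -/
theorem equation_iff_harmonic (G : C(Quadrant, ProbI)) (p : Quadrant) :
    (∀ A : Set unitInterval, MeasurableSet A →
      p.x * (∫ k, ((G p).toMeasure.real A - (G (p.shiftX k)).toMeasure.real A)
        ∂(μ : Measure (Set.Icc (0 : ℝ) β))) +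
      p.y * (∫ k, ((G p).toMeasure.real A - (G (p.shiftY k)).toMeasure.real A)
        ∂(ν : Measure (Set.Icc (0 : ℝ) β))) = 0) ↔
    ∀ f : C(unitInterval, ℝ), stepAt μ ν (fun q => ∫ s, f s ∂(G q).toMeasure) p =
      ∫ s, f s ∂(G p).toMeasure := by
  simp only [← integral_stepMeasure]
  constructor
  · intro h f
    have : (G p).toMeasure = stepMeasure μ ν G p := Measure.ext fun A hA => by
      have := (equation_iff G p hA).1 (h A hA)
      rwa [measureReal_eq_measureReal_iff] at this
    rw [← this]
  · intro h A hA
    have : (G p).toMeasure = stepMeasure μ ν G p :=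
      ext_of_forall_integral_eq_of_IsFiniteMeasure fun f => (h f.toContinuousMap).symm
    rw [equation_iff G p hA, ← this]

/-! ### The map `Γ_φ` -/

theorem integral_Gamma (φ : C(unitInterval, ProbI)) (ξ : ProbI) (f : C(unitInterval, ℝ)) :
    ∫ s, f s ∂(Gamma φ ξ).toMeasure = ∫ t, ∫ s, f s ∂(φ t).toMeasure ∂ξ.toMeasure :=
  ProbI.integral_mix ξ.toMeasure (measurable_toMeasure_comp φ) f

/-- The integral of `f` against the boundary datum. -/
def boundaryIntegral (φ : C(unitInterval, ProbI)) (f : C(unitInterval, ℝ)) :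
    C(unitInterval, ℝ) where
  toFun t := ∫ s, f s ∂(φ t).toMeasure
  continuous_toFun := (ProbI.continuous_integral f).comp φ.continuous

theorem integral_Gamma_eq (φ : C(unitInterval, ProbI)) (ξ : ProbI) (f : C(unitInterval, ℝ)) :
    ∫ s, f s ∂(Gamma φ ξ).toMeasure = ∫ t, boundaryIntegral φ f t ∂ξ.toMeasure :=
  integral_Gamma φ ξ f

/-- Testing on $f$ amounts to integrating the continuous function `boundaryIntegral φ f` against
$\xi$, which is continuous in $\xi$. -/
theorem continuous_Gamma (φ : C(unitInterval, ProbI)) : Continuous (Gamma φ) :=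
  ProbI.continuous_of_forall_integral fun f => by
    simp only [integral_Gamma_eq]
    exact ProbI.continuous_integral _

theorem Gamma_pointMass (φ : C(unitInterval, ProbI)) (t : unitInterval) :
    Gamma φ (pointMass t) = φ t :=
  ProbI.eq_of_forall_integral fun f => by
    rw [integral_Gamma_eq, integral_pointMass]
    rfl

theorem Gamma_deltaDatum (ξ : ProbI) : Gamma deltaDatum ξ = ξ :=
  ProbI.eq_of_forall_integral fun f => by
    rw [integral_Gamma]
    exact integral_congr_ae (Eventually.of_forall fun t => integral_pointMass f t)

/-- Both measures are mixtures with the same mixing measure `ξ`, so convexity of the metric applies.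
-/
theorem dist_Gamma_le (φ₁ φ₂ : C(unitInterval, ProbI)) (ξ : ProbI) :
    dist (Gamma φ₁ ξ) (Gamma φ₂ ξ) ≤ dist φ₁ φ₂ := by
  refine (ProbI.dist_mix_le ξ.toMeasure (measurable_toMeasure_comp φ₁)
    (measurable_toMeasure_comp φ₂)).trans ?_
  refine (integral_mono (ProbI.integrable_dist _ (measurable_toMeasure_comp φ₁)
    (measurable_toMeasure_comp φ₂)) (integrable_const (dist φ₁ φ₂))
    fun t => ContinuousMap.dist_apply_le_dist t).trans ?_
  simp

/-! ### Existence and uniqueness -/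

section

variable {m B : ℝ} (hμ : ∫ k, (k : ℝ) ∂(μ : Measure (Set.Icc (0 : ℝ) β)) = m)
  (hν : ∫ k, (k : ℝ) ∂(ν : Measure (Set.Icc (0 : ℝ) β)) = m)
  (hB : 0 ≤ B) (hBm : B * m = 3 * β ^ 2 + 1) (hβ : 0 ≤ β)

include hμ hν hB hBm hβ

/-- Harmonicity of `F`, tested on `boundaryIntegral φ f`, is harmonicity of $\Gamma_\varphi\circ F$
tested on $f$. The boundary values follow from $\Gamma_\varphi(\delta_t)=\varphi(t)$. -/
theorem IsLimitLaw.isSolution {F : C(Quadrant, ProbI)} (hF : IsLimitLaw μ ν F)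
    (φ : C(unitInterval, ProbI)) :
    IsSolution μ ν φ ((⟨Gamma φ, continuous_Gamma φ⟩ : C(ProbI, ProbI)).comp F) where
  equation p := by
    rw [equation_iff_harmonic]
    intro f
    simp only [ContinuousMap.comp_apply, ContinuousMap.coe_mk, integral_Gamma_eq]
    exact hF.stepAt_integral _ p
  y_axis p hp := by
    rw [ContinuousMap.comp_apply, hF.y_axis hp]
    exact Gamma_pointMass φ 0
  x_axis p hp := by
    rw [ContinuousMap.comp_apply, hF.x_axis hp]
    exact Gamma_pointMass φ 1
  at_infinity := by
    -- The point masses $\delta_{x/(x+y)}$ vary with the point, so plain continuity of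
    -- $\Gamma_\varphi$ is not enough; compactness of `ProbI` makes it uniform.
    have hu := CompactSpace.uniformContinuous_of_continuous (continuous_Gamma φ)
    have h := hF.at_infinity hμ hν hB hBm hβ
    refine Metric.tendsto_nhds.2 fun ε hε => ?_
    obtain ⟨δ, hδ, hd⟩ := Metric.uniformContinuous_iff.1 hu ε hε
    filter_upwards [Metric.tendsto_nhds.1 h δ hδ] with p hp
    rw [Real.dist_0_eq_abs, abs_of_nonneg dist_nonneg] at hp ⊢
    rw [← Gamma_pointMass φ p.ratio]
    exact hd hp

/-- A bounded harmonic function equals its expectation along the urn at every time. As $n\to\infty$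
the condition at infinity and the convergence of the proportion turn this expectation into an
integral of boundary values. -/
theorem IsSolution.eq_Gamma {F : Quadrant → ProbI} (hF : IsLimitLaw μ ν F)
    {φ : C(unitInterval, ProbI)} {G : C(Quadrant, ProbI)} (hG : IsSolution μ ν φ G)
    (p : Quadrant) : G p = Gamma φ (F p) := by
  refine ProbI.eq_of_forall_integral fun f => ?_
  have hn := isUrnNoise_noiseMeasure
  obtain ⟨Z, hZ, hlim⟩ := hn.exists_limit hμ hν hB hBm hβ p
  have hbd : ∀ q, ‖∫ s, f s ∂(G q).toMeasure‖ ≤ ‖f‖ := fun q => by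
    simpa using norm_integral_le_of_norm_le_const (μ := (G q).toMeasure) (f := f)
      (Eventually.of_forall fun s => f.norm_coe_le_norm s)
  set u : Quadrant →ᵇ ℝ := BoundedContinuousFunction.ofNormedAddCommGroup
    (fun q => ∫ s, f s ∂(G q).toMeasure) ((ProbI.continuous_integral f).comp G.continuous) ‖f‖ hbd
  have hu : stepOp μ ν u = u := BoundedContinuousFunction.ext fun q =>
    (equation_iff_harmonic G q).1 (hG.equation q) f
  have hT := hn.tendsto_iterate_stepOp (μ := μ) (ν := ν) p hZ (fun _ => u)
    (boundaryIntegral φ f) (boundaryIntegral φ f).continuous ‖f‖ (fun _ => hbd) (by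
      filter_upwards [hlim, hn.ae_tendsto_height hμ hν hB hBm hβ p] with ω hω hh
      have h1 := hG.at_infinity.comp (tendsto_comap_iff.2 hh)
      have h2 := (φ.continuous.tendsto _).comp hω
      have h3 := (tendsto_iff_of_dist h1).2 h2
      exact ((ProbI.continuous_integral f).tendsto _).comp h3)
  rw [hF.eq_law hn p hZ hlim, integral_Gamma_eq]
  simp only [Function.iterate_fixed hu] at hT
  exact tendsto_nhds_unique tendsto_const_nhds hT

end

/-- Uses $t/(1+t)\le t$ for $t\ge0$ and $\sum_{n\ge1}2^{-n}=1$. -/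
theorem solutionDist_le_of_forall_dist_le {G₁ G₂ : C(Quadrant, ProbI)} {D : ℝ} (hD : 0 ≤ D)
    (h : ∀ p, dist (G₁ p) (G₂ p) ≤ D) : solutionDist G₁ G₂ ≤ D := by
  have h0 : ∀ n, 0 ≤ solutionDistOn n G₁ G₂ := fun n => Real.iSup_nonneg fun p => dist_nonneg
  have h1 : ∀ n, solutionDistOn n G₁ G₂ ≤ D := fun n => Real.iSup_le (fun p => h p) hD
  have hgeom : HasSum (fun n : ℕ => (1 : ℝ) / 2 ^ (n + 1) * D) D := by
    have := (hasSum_geometric_two' (1 : ℝ)).mul_right D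
    rw [one_mul] at this
    refine this.congr_fun fun n => ?_
    rw [pow_succ, div_div, mul_comm ((2 : ℝ) ^ n) 2]
  have hterm : ∀ n : ℕ, (1 : ℝ) / 2 ^ (n + 1) *
      (solutionDistOn (n + 1) G₁ G₂ / (1 + solutionDistOn (n + 1) G₁ G₂)) ≤
      1 / 2 ^ (n + 1) * D := fun n => by
    have := h0 (n + 1)
    refine mul_le_mul_of_nonneg_left ?_ (by positivity)
    exact (div_le_self this (by linarith)).trans (h1 _)
  have hnn : ∀ n : ℕ, 0 ≤ (1 : ℝ) / 2 ^ (n + 1) *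
      (solutionDistOn (n + 1) G₁ G₂ / (1 + solutionDistOn (n + 1) G₁ G₂)) := fun n => by
    have := h0 (n + 1)
    positivity
  rw [solutionDist, ← hgeom.tsum_eq]
  exact (Summable.of_nonneg_of_le hnn hterm hgeom.summable).tsum_le_tsum hterm hgeom.summable
end

/-! ### Proof of the theorem -/

theorem mainTheorem1 (β m₀ : ℝ) (hm₀ : 0 < m₀) (hβ : m₀ ≤ β)
    (μ ν : ProbabilityMeasure (Set.Icc (0 : ℝ) β)) (hμν : (μ, ν) ∈ paramSet β m₀) :
    -- existence and uniqueness
    (∀ φ : C(unitInterval, ProbI), ∃! G : C(Quadrant, ProbI), IsSolution μ ν φ G) ∧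
    -- 1-Lipschitz dependence on the boundary datum
    (∀ (φ₁ φ₂ : C(unitInterval, ProbI)) (G₁ G₂ : C(Quadrant, ProbI)),
      IsSolution μ ν φ₁ G₁ → IsSolution μ ν φ₂ G₂ → solutionDist G₁ G₂ ≤ dist φ₁ φ₂) ∧
    -- the canonical solution
    ∃ F : C(Quadrant, ProbI),
      IsSolution μ ν deltaDatum F ∧
      -- its values are the laws of the limit proportion in the urn
      (∀ {Ω : Type*} [MeasurableSpace Ω] (P : Measure Ω) [IsProbabilityMeasure P]
        (U V W : ℕ → Ω → unitInterval), IsUrnNoise P U V W → ∀ p : Quadrant,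
        ∃ Z : Ω → unitInterval, Measurable Z ∧
          (∀ᵐ ω ∂P, Tendsto (fun n => (urn μ ν U V W p ω n).ratio) atTop (𝓝 (Z ω))) ∧
          P.map Z = (F p).toMeasure) ∧
      -- the solution for a general boundary datum
      (∀ (φ : C(unitInterval, ProbI)) (G : C(Quadrant, ProbI)),
        IsSolution μ ν φ G → ∀ p : Quadrant, G p = Gamma φ (F p)) := by

  obtain ⟨hmean, hm⟩ := hμν
  have hβ0 : 0 ≤ β := hm₀.le.trans hβ
  set m := ∫ k, (k : ℝ) ∂(μ : Measure (Set.Icc (0 : ℝ) β)) with hmdef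
  have hmpos : 0 < m := hm₀.trans_le hm
  have hν : ∫ k, (k : ℝ) ∂(ν : Measure (Set.Icc (0 : ℝ) β)) = m := hmean.symm
  -- This is the constant $B$ of the Lyapunov function; it requires a positive mean $m$, which
  -- $m_0>0$ guarantees.
  have hB : 0 ≤ (3 * β ^ 2 + 1) / m := by positivity
  have hBm : (3 * β ^ 2 + 1) / m * m = 3 * β ^ 2 + 1 := div_mul_cancel₀ _ hmpos.ne'
  obtain ⟨F₀, hF₀⟩ := exists_isLimitLaw hmdef.symm hν hB hBm hβ0
  set F : C(Quadrant, ProbI) := ⟨F₀, hF₀.continuous hmdef.symm hν hB hBm hβ0⟩ with hFdef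
  have hF : IsLimitLaw μ ν F := hF₀
  have hsol := hF.isSolution hmdef.symm hν hB hBm hβ0
  have hrep : ∀ (φ : C(unitInterval, ProbI)) (G : C(Quadrant, ProbI)),
      IsSolution μ ν φ G → ∀ p : Quadrant, G p = Gamma φ (F p) := fun φ G hG p =>
    hG.eq_Gamma hmdef.symm hν hB hBm hβ0 hF p
  refine ⟨fun φ => ⟨_, hsol φ, fun G hG => ContinuousMap.ext fun p => hrep φ G hG p⟩,
    fun φ₁ φ₂ G₁ G₂ h₁ h₂ => solutionDist_le_of_forall_dist_le dist_nonneg fun p => ?_,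
    F, ?_, ?_, hrep⟩
  · rw [hrep φ₁ G₁ h₁ p, hrep φ₂ G₂ h₂ p]
    exact dist_Gamma_le φ₁ φ₂ (F p)
  -- For the datum $\delta$ the map $\Gamma_\delta$ is the identity, so `F` itself is the solution.
  · convert hsol deltaDatum using 1
    exact ContinuousMap.ext fun p => (Gamma_deltaDatum (F p)).symm
  · intro Ω _ P _ U V W h p
    obtain ⟨Z, hZ, hlim⟩ := h.exists_limit hmdef.symm hν hB hBm hβ0 p
    refine ⟨Z, hZ, hlim, ?_⟩
    rw [hF.eq_law h p hZ hlim, ProbI.law_toMeasure]
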